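/- Let $\theta_1=\sqrt{\frac{3\sqrt{21}+9}{224}}$ and $\theta_3=\sqrt{\frac{3\sqrt{21}+3\sqrt7+7\sqrt3+21}{48384}}$, and let $\theta_2$ be any real root of $$f(x)=x^3-\frac{\sqrt{21}-3}{28}\,x+\frac{21-5\sqrt{21}}{126}\,\theta_1 .$$ Put $$\begin{aligned} v_1={}&\Bigl(\bigl(336(\sqrt7-\sqrt{21})\theta_1-42\sqrt{21}-42\sqrt3-126\sqrt7-378\bigr)\theta_2^2\\ &+\bigl(56(3\sqrt7-2\sqrt3+3)\theta_1+3\sqrt{21}-21\sqrt3+9\sqrt7+63\bigr)\theta_2\\ &+(168-24\sqrt{21}-56\sqrt3+24\sqrt7)\theta_1+6\sqrt{21}+18\sqrt3-6\sqrt7-6\Bigr)i\\ &+\bigl(336(\sqrt7+\sqrt{21})\theta_1+42\sqrt{21}-42\sqrt3-126\sqrt7+378\bigr)\theta_2^2\\ &+\bigl(56(3\sqrt7-2\sqrt3-3)\theta_1-3\sqrt{21}-21\sqrt3+9\sqrt7-63\bigr)\theta_2\\ &+(24\sqrt{21}-56\sqrt3+24\sqrt7-168)\theta_1-6\sqrt{21}+18\sqrt3-6\sqrt7+6,\\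 v_2={}&\Bigl(\bigl(672(\sqrt7-\sqrt{21})\theta_1-168\sqrt3+504\bigr)\theta_2^2\\ &+\bigl(28(3\sqrt{21}+5\sqrt3-3\sqrt7-15)\theta_1-42\sqrt3+126\bigr)\theta_2\\ &+(336-48\sqrt{21}-112\sqrt3+48\sqrt7)\theta_1-12\sqrt{21}-12\sqrt3+12\sqrt7+36\Bigr)i\\ &-(84\sqrt{21}-252\sqrt3-252\sqrt7+252)\theta_2^2\\ &+\bigl(84(\sqrt{21}+\sqrt3-3\sqrt7-1)\theta_1-6\sqrt{21}+18\sqrt7\bigr)\theta_2-24\sqrt3+24,\\ v_3={}&6(\sqrt7-\sqrt3)i+6\sqrt{21}+12\sqrt3-12\sqrt7-18,\\ v_4={}&\Bigl(\bigl(336(\sqrt7-\sqrt{21})\theta_1+126\sqrt{21}-42\sqrt3-126\sqrt7+126\bigr)\theta_2^2\\ &+\bigl(56(6-3\sqrt{21}-2\sqrt3+3\sqrt7)\theta_1-9\sqrt{21}-21\sqrt3+9\sqrt7+63\bigr)\theta_2\\ &+(168-24\sqrt{21}-56\sqrt3+24\sqrt7)\theta_1+6\sqrt{21}+18\sqrt3-6\sqrt7-54\Bigr)i\\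 &+\bigl(336(\sqrt{21}-3\sqrt7)\theta_1+42\sqrt{21}-378\sqrt3-126\sqrt7+378\bigr)\theta_2^2\\ &+\bigl(168(\sqrt3-1)\theta_1-3\sqrt{21}+63\sqrt3+9\sqrt7-63\bigr)\theta_2\\ &+(24\sqrt{21}+168\sqrt3-72\sqrt7-168)\theta_1+6-6\sqrt{21}-6\sqrt3+18\sqrt7,\\ v_5={}&\Bigl(\bigl(672\sqrt7\,\theta_1+84\sqrt{21}-168\sqrt3+252\bigr)\theta_2^2\\ &-\bigl((84\sqrt{21}-140\sqrt3+84\sqrt7-84)\theta_1-6\sqrt{21}+42\sqrt3\bigr)\theta_2\\ &-(112\sqrt3\,\theta_1-48\sqrt7\,\theta_1+12\sqrt3-12\sqrt7+24)\Bigr)i\\ &+(672\sqrt7\,\theta_1-84\sqrt{21}-168\sqrt3-252)\theta_2^2\\ &+\bigl((84\sqrt{21}+140\sqrt3-84\sqrt7-84)\theta_1-6\sqrt{21}-42\sqrt3\bigr)\theta_2\\ &-112\sqrt3\,\theta_1+48\sqrt7\,\theta_1-12\sqrt3+12\sqrt7+24,\\ v_6={}&6(\sqrt7-\sqrt3)i-6\sqrt{21}+18,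 \end{aligned}$$ and $\phi_0=\theta_3(v_1,v_2,v_3,v_4,v_5,v_6)^t\in\mathbb C^6$. With coordinates indexed by $0,\dots,5$ modulo $6$ and $\omega=e^{2\pi i/6}$, let $X=\sum_j|j+1\rangle\langle j|$ and $Z=\sum_j\omega^j|j\rangle\langle j|$, and let $H_6\subset GL(6,\mathbb C)$ be the (Heisenberg) group generated by $X$ and $Z$. Then: 1. the field $\mathbb K=\mathbb Q(\sqrt3,\sqrt7,\theta_1,\theta_2,\theta_3,i)\subset\mathbb C$ has degree $96$ over $\mathbb Q$, and all entries of $\phi_0$ lie in $\mathbb K$; 2. $\langle\phi_0|\phi_0\rangle=1$, and the orbit $\{hE_0h^{-1}: h\in H_6\}$ of $E_0=\frac16|\phi_0\rangle\langle\phi_0|$ is a SIC-POVM in dimension $6$: it is an informationally complete POVM (positive operators with sum $I$ whose statistics $\mathrm{Tr}(E\rho)$ determine every density matrix $\rho$) consisting of exactly $36$ operators $\Pi/6$, with $\Pi$ rank-one projectors that satisfy $\mathrm{Tr}(\Pi\Pi')=\frac17$ whenever $\Pi\neq\Pi'$; 3. $|\langle\phi_0|X^aZ^b\phi_0\rangle|^2=\frac17$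 for all $a,b\in\{0,\dots,5\}$ with $(a,b)\ne(0,0)$. -/

import Mathlib

noncomputable section

namespace SIC6

open Matrix
open scoped ComplexOrder

section General

/-- The primitive `d`-th root of unity `exp (2 π i / d)`. -/
def rootOfUnity (d : ℕ) : ℂ := Complex.exp (2 * Real.pi * Complex.I / d)

/-- The cyclic shift `∑ j, |j+1⟩⟨j|`, with `j + 1` taken modulo `d`. -/
def shiftX (d : ℕ) [NeZero d] : Matrix (Fin d) (Fin d) ℂ :=
  Matrix.of fun k j => if k = j + 1 then 1 else 0

/-- The phase operator `∑ j, ω ^ j |j⟩⟨j|`. -/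
def phaseZ (d : ℕ) : Matrix (Fin d) (Fin d) ℂ :=
  Matrix.diagonal fun j => rootOfUnity d ^ (j : ℕ)

theorem isUnit_shiftX (d : ℕ) [NeZero d] : IsUnit (shiftX d) := by
  refine IsUnit.of_mul_eq_one (shiftX d)ᵀ ?_
  ext a b
  rw [Matrix.mul_apply, Finset.sum_eq_single (a - 1)]
  · by_cases h : a = b
    · simp [shiftX, h, Matrix.one_apply]
    · simp [shiftX, h, Ne.symm h]
  · intro j _ hj
    have : a ≠ j + 1 := fun h => hj (by simp [h])
    simp [shiftX, this]
  · simp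

theorem isUnit_phaseZ (d : ℕ) : IsUnit (phaseZ d) := by
  rw [phaseZ, Matrix.isUnit_diagonal, Pi.isUnit_iff]
  intro j
  exact (isUnit_iff_ne_zero.mpr (Complex.exp_ne_zero _)).pow _

/-- The Heisenberg group `H_d`, the subgroup of `GL(d, ℂ)` generated by `X` and `Z`. -/
def heisenbergGroup (d : ℕ) [NeZero d] : Subgroup (GL (Fin d) ℂ) :=
  Subgroup.closure {(isUnit_shiftX d).unit, (isUnit_phaseZ d).unit}

/-- The operator `|φ⟩⟨φ|`. -/
def ketBra {d : ℕ} (φ : Fin d → ℂ) : Matrix (Fin d) (Fin d) ℂ :=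
  Matrix.vecMulVec φ (star φ)

/-- The orbit `{h E h⁻¹ : h ∈ H_d}`. -/
def heisenbergOrbit (d : ℕ) [NeZero d] (E : Matrix (Fin d) (Fin d) ℂ) :
    Set (Matrix (Fin d) (Fin d) ℂ) :=
  {F | ∃ h ∈ heisenbergGroup d,
    F = (h : Matrix (Fin d) (Fin d) ℂ) * E * ((h⁻¹ : GL (Fin d) ℂ) : Matrix (Fin d) (Fin d) ℂ)}

/-- A (finite) positive operator valued measure: finitely many positive operators with sum `1`. -/
structure IsPOVM {d : ℕ} (S : Set (Matrix (Fin d) (Fin d) ℂ)) : Prop where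
  finite : S.Finite
  posSemidef : ∀ E ∈ S, E.PosSemidef
  sum_eq_one : ∑ E ∈ finite.toFinset, E = 1

/-- The measurement statistics `E ↦ Tr (E ρ)` determine the quantum state (density matrix) `ρ`. -/
def IsInformationallyComplete {d : ℕ} (S : Set (Matrix (Fin d) (Fin d) ℂ)) : Prop :=
  ∀ ρ σ : Matrix (Fin d) (Fin d) ℂ, ρ.PosSemidef → ρ.trace = 1 → σ.PosSemidef → σ.trace = 1 →
    (∀ E ∈ S, (E * ρ).trace = (E * σ).trace) → ρ = σ

/-- A symmetric informationally complete POVM in dimension `d`: it consists of `d ^ 2` operators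
`Π / d`, with `Π = |ψ⟩⟨ψ|` rank-one projectors satisfying `Tr (Π Π') = 1 / (d + 1)` for any two
different ones. -/
structure IsSICPOVM {d : ℕ} (S : Set (Matrix (Fin d) (Fin d) ℂ)) : Prop where
  isPOVM : IsPOVM S
  informationallyComplete : IsInformationallyComplete S
  card : S.ncard = d ^ 2
  rankOne : ∀ E ∈ S, ∃ ψ : Fin d → ℂ, star ψ ⬝ᵥ ψ = 1 ∧ (d : ℂ) • E = ketBra ψ
  symmetric : ∀ E ∈ S, ∀ F ∈ S, E ≠ F →
    (((d : ℂ) • E) * ((d : ℂ) • F)).trace = 1 / ((d : ℂ) + 1)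

/-- The vector `φ` is a normalized state such that the orbit of `|φ⟩⟨φ| / d` under the Heisenberg
group is a SIC-POVM. -/
def IsHeisenbergFiducial (d : ℕ) [NeZero d] (φ : Fin d → ℂ) : Prop :=
  star φ ⬝ᵥ φ = 1 ∧ IsSICPOVM (heisenbergOrbit d ((d : ℂ)⁻¹ • ketBra φ))

end General

section Solution

def θ₁ : ℝ := √((3 * √21 + 9) / 224)

def θ₃ : ℝ := √((3 * √21 + 3 * √7 + 7 * √3 + 21) / 48384)

/-- The cubic polynomial `f`, of which `θ₂` is a real root. -/
def f (x : ℝ) : ℝ := x ^ 3 - (√21 - 3) / 28 * x + (21 - 5 * √21) / 126 * θ₁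

def v₁ (θ₂ : ℝ) : ℂ :=
  (((336 * (√7 - √21) * θ₁ - 42 * √21 - 42 * √3 - 126 * √7 - 378) * θ₂ ^ 2
      + (56 * (3 * √7 - 2 * √3 + 3) * θ₁ + 3 * √21 - 21 * √3 + 9 * √7 + 63) * θ₂
      + (168 - 24 * √21 - 56 * √3 + 24 * √7) * θ₁ + 6 * √21 + 18 * √3 - 6 * √7 - 6 : ℝ) : ℂ)
    * Complex.I
  + (((336 * (√7 + √21) * θ₁ + 42 * √21 - 42 * √3 - 126 * √7 + 378) * θ₂ ^ 2
      + (56 * (3 * √7 - 2 * √3 - 3) * θ₁ - 3 * √21 - 21 * √3 + 9 * √7 - 63) * θ₂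
      + (24 * √21 - 56 * √3 + 24 * √7 - 168) * θ₁ - 6 * √21 + 18 * √3 - 6 * √7 + 6 : ℝ) : ℂ)

def v₂ (θ₂ : ℝ) : ℂ :=
  (((672 * (√7 - √21) * θ₁ - 168 * √3 + 504) * θ₂ ^ 2
      + (28 * (3 * √21 + 5 * √3 - 3 * √7 - 15) * θ₁ - 42 * √3 + 126) * θ₂
      + (336 - 48 * √21 - 112 * √3 + 48 * √7) * θ₁ - 12 * √21 - 12 * √3 + 12 * √7 + 36 : ℝ) : ℂ)
    * Complex.I
  + ((-(84 * √21 - 252 * √3 - 252 * √7 + 252) * θ₂ ^ 2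
      + (84 * (√21 + √3 - 3 * √7 - 1) * θ₁ - 6 * √21 + 18 * √7) * θ₂ - 24 * √3 + 24 : ℝ) : ℂ)

def v₃ : ℂ :=
  ((6 * (√7 - √3) : ℝ) : ℂ) * Complex.I + ((6 * √21 + 12 * √3 - 12 * √7 - 18 : ℝ) : ℂ)

def v₄ (θ₂ : ℝ) : ℂ :=
  (((336 * (√7 - √21) * θ₁ + 126 * √21 - 42 * √3 - 126 * √7 + 126) * θ₂ ^ 2
      + (56 * (6 - 3 * √21 - 2 * √3 + 3 * √7) * θ₁ - 9 * √21 - 21 * √3 + 9 * √7 + 63) * θ₂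
      + ((168 - 24 * √21 - 56 * √3 + 24 * √7) * θ₁ + 6 * √21 + 18 * √3 - 6 * √7 - 54) : ℝ) : ℂ)
    * Complex.I
  + (((336 * (√21 - 3 * √7) * θ₁ + 42 * √21 - 378 * √3 - 126 * √7 + 378) * θ₂ ^ 2
      + (168 * (√3 - 1) * θ₁ - 3 * √21 + 63 * √3 + 9 * √7 - 63) * θ₂
      + (24 * √21 + 168 * √3 - 72 * √7 - 168) * θ₁
      + 6 - 6 * √21 - 6 * √3 + 18 * √7 : ℝ) : ℂ)

def v₅ (θ₂ : ℝ) : ℂ :=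
  (((672 * √7 * θ₁ + 84 * √21 - 168 * √3 + 252) * θ₂ ^ 2
      - ((84 * √21 - 140 * √3 + 84 * √7 - 84) * θ₁ - 6 * √21 + 42 * √3) * θ₂
      - (112 * √3 * θ₁ - 48 * √7 * θ₁ + 12 * √3 - 12 * √7 + 24) : ℝ) : ℂ)
    * Complex.I
  + (((672 * √7 * θ₁ - 84 * √21 - 168 * √3 - 252) * θ₂ ^ 2
      + ((84 * √21 + 140 * √3 - 84 * √7 - 84) * θ₁ - 6 * √21 - 42 * √3) * θ₂
      - 112 * √3 * θ₁ + 48 * √7 * θ₁ - 12 * √3 + 12 * √7 + 24 : ℝ) : ℂ)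

def v₆ : ℂ :=
  ((6 * (√7 - √3) : ℝ) : ℂ) * Complex.I + ((-6 * √21 + 18 : ℝ) : ℂ)

/-- The initial state `θ₃ (v₁, v₂, v₃, v₄, v₅, v₆)ᵗ`. -/
def φ₀ (θ₂ : ℝ) : Fin 6 → ℂ :=
  (θ₃ : ℂ) • ![v₁ θ₂, v₂ θ₂, v₃, v₄ θ₂, v₅ θ₂, v₆]

/-- The field `ℚ(√3, √7, θ₁, θ₂, θ₃, i)`, as a subfield of `ℂ`. -/
def K (θ₂ : ℝ) : IntermediateField ℚ ℂ :=
  IntermediateField.adjoin ℚ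
    {((√3 : ℝ) : ℂ), ((√7 : ℝ) : ℂ), (θ₁ : ℂ), (θ₂ : ℂ), (θ₃ : ℂ), Complex.I}

end Solution

end SIC6

end

/-! Everything about `φ₀` reduces to finitely many exact overlap identities and one degree
computation.

Overlaps. The entries of 1176 v lie in the order ℤ[√3, √7, t, x][i] with t = 56 θ₁, x = 84 θ₂, where
t² and x³ reduce by the defining relations. All 36 overlaps are computed in these coordinates by the
kernel (`scaledOverlap_zero`, `conjMul_scaledOverlap`). Only the relation `f θ₂ = 0` is used, so the
choice of real root is irrelevant. The squared moduli for (a, b) ≠ (0, 0) all coincide and involve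
neither t nor x; multiplying by θ₃⁴ gives 1/7.

SIC property. Heisenberg group elements are phases times X ^ a Z ^ b, so the orbit is indexed by (a,
b), and the overlap of two displaced vectors depends, up to a phase, only on the difference of
indices. Hence the vectors are equiangular. For d² equiangular vectors the projectors have Gram
matrix (d I + J)/(d + 1), with J the all-ones matrix; this yields linear independence, the
resolution of the identity and informational completeness (`isSICPOVM_of_equiangular`).

Degree. The tower ℚ ⊂ ℚ(√21) ⊂ (√3) ⊂ (θ₁) ⊂ (θ₃) ⊂ (i) has five quadratic steps, checked by norms,
and the last by reality. The number 3 θ₂ / (2 θ₁) is a root of a cubic over ℚ(√21) that has no root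
there by a descent modulo 5. Quadratic extensions create no roots (`cubic_ne_zero_of_adjoinOver`),
so the final step has degree 3 and the total is 32 · 3. -/

namespace SIC6

/-! ### Exact arithmetic with coordinates in an order of the real field. -/

section Arithmetic

/-- Pairs `(re, im)`, standing for `re + im * √d`. -/
structure QuadExt (R : Type) (d : R) where
  re : R
  im : R
  deriving DecidableEq

/-- Triples `(c₀, c₁, c₂)`, standing for `c₀ + c₁ * x + c₂ * x ^ 2` with `x ^ 3 = p * x + q`. -/
structure CubicExt (R : Type) (p q : R) where
  c₀ : R
  c₁ : R
  c₂ : R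
  deriving DecidableEq

variable {R : Type}

instance {d : R} [Add R] : Add (QuadExt R d) := ⟨fun x y => ⟨x.re + y.re, x.im + y.im⟩⟩

instance {d : R} [Neg R] : Neg (QuadExt R d) := ⟨fun x => ⟨-x.re, -x.im⟩⟩

instance {d : R} [Add R] [Mul R] : Mul (QuadExt R d) :=
  ⟨fun x y => ⟨x.re * y.re + d * (x.im * y.im), x.re * y.im + x.im * y.re⟩⟩

instance {p q : R} [Add R] : Add (CubicExt R p q) :=
  ⟨fun x y => ⟨x.c₀ + y.c₀, x.c₁ + y.c₁, x.c₂ + y.c₂⟩⟩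

instance {p q : R} [Neg R] : Neg (CubicExt R p q) := ⟨fun x => ⟨-x.c₀, -x.c₁, -x.c₂⟩⟩

instance {p q : R} [Add R] [Mul R] : Mul (CubicExt R p q) :=
  ⟨fun x y =>
    ⟨x.c₀ * y.c₀ + q * (x.c₁ * y.c₂ + x.c₂ * y.c₁),
      x.c₀ * y.c₁ + x.c₁ * y.c₀ + p * (x.c₁ * y.c₂ + x.c₂ * y.c₁) + q * (x.c₂ * y.c₂),
      x.c₀ * y.c₂ + x.c₁ * y.c₁ + x.c₂ * y.c₀ + p * (x.c₂ * y.c₂)⟩⟩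

/-- The ring `ℤ[√3, √7]`. -/
abbrev QuadInt : Type := QuadExt (QuadExt ℤ 3) ⟨7, 0⟩

/-- The ring `ℤ[√3, √7, t]` with `t = 56 θ₁`. -/
abbrev ThetaInt : Type := QuadExt QuadInt ⟨⟨126, 0⟩, ⟨0, 42⟩⟩

/-- The ring `ℤ[√3, √7, t, x]` with `t = 56 θ₁` and `x = 84 θ₂`. -/
abbrev RealInt : Type :=
  CubicExt ThetaInt ⟨⟨⟨-756, 0⟩, ⟨0, 252⟩⟩, ⟨⟨0, 0⟩, ⟨0, 0⟩⟩⟩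
    ⟨⟨⟨0, 0⟩, ⟨0, 0⟩⟩, ⟨⟨-1764, 0⟩, ⟨0, 420⟩⟩⟩

/-- The product `conj z * w` of two complex numbers in cartesian form. -/
def conjMul [Add R] [Neg R] [Mul R] (z w : R × R) : R × R :=
  (z.1 * w.1 + z.2 * w.2, z.1 * w.2 + -(z.2 * w.1))

/-- Apply `f` to both coordinates. -/
def QuadExt.map {d : R} (f : R → R) (x : QuadExt R d) : QuadExt R d := ⟨f x.re, f x.im⟩

/-- Apply `f` to the three coordinates. -/
def CubicExt.map {p q : R} (f : R → R) (x : CubicExt R p q) : CubicExt R p q :=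
  ⟨f x.c₀, f x.c₁, f x.c₂⟩

/-- Multiplication of an element of `ℤ[√3, √7, t, x]` by an element of `ℤ[√3]`. -/
def RealInt.scale (s : QuadExt ℤ 3) (y : RealInt) : RealInt :=
  y.map (QuadExt.map (QuadExt.map (s * ·)))

/-- The numbers `2 ω ^ k` in cartesian form. -/
def twiceRoot : Fin 6 → QuadExt ℤ 3 × QuadExt ℤ 3 :=
  ![(⟨2, 0⟩, ⟨0, 0⟩), (⟨1, 0⟩, ⟨0, 1⟩), (⟨-1, 0⟩, ⟨0, 1⟩),
    (⟨-2, 0⟩, ⟨0, 0⟩), (⟨-1, 0⟩, ⟨0, -1⟩), (⟨1, 0⟩, ⟨0, -1⟩)]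

/-- The product of a complex number over `ℤ[√3]` and one over `ℤ[√3, √7, t, x]`. -/
def RealInt.complexScale (s : QuadExt ℤ 3 × QuadExt ℤ 3) (z : RealInt × RealInt) :
    RealInt × RealInt :=
  (scale s.1 z.1 + scale (-s.2) z.2, scale s.1 z.2 + scale s.2 z.1)

set_option maxRecDepth 100000 in
/-- The vector `1176 (v₁, …, v₆)` in cartesian form. -/
noncomputable def scaledVec : Fin 6 → RealInt × RealInt :=
  ![
      ⟨⟨⟨⟨⟨7056, 21168⟩, ⟨-7056, -7056⟩⟩, ⟨⟨-3528, -1176⟩, ⟨504, 504⟩⟩⟩, ⟨⟨⟨-882, -294⟩, ⟨126, -42⟩⟩, ⟨⟨-42, -28⟩, ⟨42, 0⟩⟩⟩, ⟨⟨⟨63, -7⟩, ⟨-21, 7⟩⟩, ⟨⟨0, 0⟩, ⟨1, 1⟩⟩⟩⟩,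
        ⟨⟨⟨⟨-7056, 21168⟩, ⟨-7056, 7056⟩⟩, ⟨⟨3528, -1176⟩, ⟨504, -504⟩⟩⟩, ⟨⟨⟨882, -294⟩, ⟨126, 42⟩⟩, ⟨⟨42, -28⟩, ⟨42, 0⟩⟩⟩, ⟨⟨⟨-63, -7⟩, ⟨-21, -7⟩⟩, ⟨⟨0, 0⟩, ⟨1, -1⟩⟩⟩⟩⟩,
      ⟨⟨⟨⟨⟨28224, -28224⟩, ⟨0, 0⟩⟩, ⟨⟨0, 0⟩, ⟨0, 0⟩⟩⟩, ⟨⟨⟨0, 0⟩, ⟨252, -84⟩⟩, ⟨⟨-21, 21⟩, ⟨-63, 21⟩⟩⟩, ⟨⟨⟨-42, 42⟩, ⟨42, -14⟩⟩, ⟨⟨0, 0⟩, ⟨0, 0⟩⟩⟩⟩,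
        ⟨⟨⟨⟨42336, -14112⟩, ⟨14112, -14112⟩⟩, ⟨⟨7056, -2352⟩, ⟨1008, -1008⟩⟩⟩, ⟨⟨⟨1764, -588⟩, ⟨0, 0⟩⟩, ⟨⟨-105, 35⟩, ⟨-21, 21⟩⟩⟩, ⟨⟨⟨84, -28⟩, ⟨0, 0⟩⟩, ⟨⟨0, 0⟩, ⟨2, -2⟩⟩⟩⟩⟩,
      ⟨⟨⟨⟨⟨-21168, 14112⟩, ⟨-14112, 7056⟩⟩, ⟨⟨0, 0⟩, ⟨0, 0⟩⟩⟩, ⟨⟨⟨0, 0⟩, ⟨0, 0⟩⟩, ⟨⟨0, 0⟩, ⟨0, 0⟩⟩⟩, ⟨⟨⟨0, 0⟩, ⟨0, 0⟩⟩, ⟨⟨0, 0⟩, ⟨0, 0⟩⟩⟩⟩,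
        ⟨⟨⟨⟨0, -7056⟩, ⟨7056, 0⟩⟩, ⟨⟨0, 0⟩, ⟨0, 0⟩⟩⟩, ⟨⟨⟨0, 0⟩, ⟨0, 0⟩⟩, ⟨⟨0, 0⟩, ⟨0, 0⟩⟩⟩, ⟨⟨⟨0, 0⟩, ⟨0, 0⟩⟩, ⟨⟨0, 0⟩, ⟨0, 0⟩⟩⟩⟩⟩,
      ⟨⟨⟨⟨⟨7056, -7056⟩, ⟨21168, -7056⟩⟩, ⟨⟨-3528, 3528⟩, ⟨-1512, 504⟩⟩⟩, ⟨⟨⟨-882, 882⟩, ⟨126, -42⟩⟩, ⟨⟨-42, 42⟩, ⟨0, 0⟩⟩⟩, ⟨⟨⟨63, -63⟩, ⟨-21, 7⟩⟩, ⟨⟨0, 0⟩, ⟨-3, 1⟩⟩⟩⟩,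
        ⟨⟨⟨⟨-63504, 21168⟩, ⟨-7056, 7056⟩⟩, ⟨⟨3528, -1176⟩, ⟨504, -504⟩⟩⟩, ⟨⟨⟨882, -294⟩, ⟨126, -126⟩⟩, ⟨⟨84, -28⟩, ⟨42, -42⟩⟩⟩, ⟨⟨⟨21, -7⟩, ⟨-21, 21⟩⟩, ⟨⟨0, 0⟩, ⟨1, -1⟩⟩⟩⟩⟩,
      ⟨⟨⟨⟨⟨28224, -14112⟩, ⟨14112, 0⟩⟩, ⟨⟨0, -2352⟩, ⟨1008, 0⟩⟩⟩, ⟨⟨⟨0, -588⟩, ⟨0, -84⟩⟩, ⟨⟨-21, 35⟩, ⟨-21, 21⟩⟩⟩, ⟨⟨⟨-42, -28⟩, ⟨0, -14⟩⟩, ⟨⟨0, 0⟩, ⟨2, 0⟩⟩⟩⟩,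
        ⟨⟨⟨⟨-28224, -14112⟩, ⟨14112, 0⟩⟩, ⟨⟨0, -2352⟩, ⟨1008, 0⟩⟩⟩, ⟨⟨⟨0, -588⟩, ⟨0, 84⟩⟩, ⟨⟨21, 35⟩, ⟨-21, -21⟩⟩⟩, ⟨⟨⟨42, -28⟩, ⟨0, 14⟩⟩, ⟨⟨0, 0⟩, ⟨2, 0⟩⟩⟩⟩⟩,
      ⟨⟨⟨⟨⟨21168, 0⟩, ⟨0, -7056⟩⟩, ⟨⟨0, 0⟩, ⟨0, 0⟩⟩⟩, ⟨⟨⟨0, 0⟩, ⟨0, 0⟩⟩, ⟨⟨0, 0⟩, ⟨0, 0⟩⟩⟩, ⟨⟨⟨0, 0⟩, ⟨0, 0⟩⟩, ⟨⟨0, 0⟩, ⟨0, 0⟩⟩⟩⟩,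
        ⟨⟨⟨⟨0, -7056⟩, ⟨7056, 0⟩⟩, ⟨⟨0, 0⟩, ⟨0, 0⟩⟩⟩, ⟨⟨⟨0, 0⟩, ⟨0, 0⟩⟩, ⟨⟨0, 0⟩, ⟨0, 0⟩⟩⟩, ⟨⟨⟨0, 0⟩, ⟨0, 0⟩⟩, ⟨⟨0, 0⟩, ⟨0, 0⟩⟩⟩⟩⟩]

/-- The overlap `2 * 1176 ^ 2 * ⟨v|X ^ a Z ^ b v⟩` in cartesian form. -/
noncomputable def scaledOverlap (a b : Fin 6) : RealInt × RealInt :=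
  let c (j : Fin 6) :=
    RealInt.complexScale (twiceRoot (b * j)) (conjMul (scaledVec (j + a)) (scaledVec j))
  c 0 + c 1 + c 2 + c 3 + c 4 + c 5

/-- The embedding `ℤ[√3, √7] → ℤ[√3, √7, t, x]`. -/
def RealInt.ofQuadInt (y : QuadInt) : RealInt :=
  ⟨⟨y, ⟨⟨0, 0⟩, ⟨0, 0⟩⟩⟩, ⟨⟨⟨0, 0⟩, ⟨0, 0⟩⟩, ⟨⟨0, 0⟩, ⟨0, 0⟩⟩⟩,
    ⟨⟨⟨0, 0⟩, ⟨0, 0⟩⟩, ⟨⟨0, 0⟩, ⟨0, 0⟩⟩⟩⟩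

/-- The coordinates on t and x cancel. The remaining value is 2 · 1176² / θ₃², which is what
normalizes `φ₀`; see `θ₃_sq_mul`. -/
theorem scaledOverlap_zero : scaledOverlap 0 0 =
    (.ofQuadInt ⟨⟨16728477696, -5576159232⟩, ⟨2389782528, -2389782528⟩⟩,
      .ofQuadInt ⟨⟨0, 0⟩, ⟨0, 0⟩⟩) := by
  decide +kernel

/-- The computational heart: 35 squared moduli agree coordinate by coordinate. The common value is
one seventh of the square of the value in `scaledOverlap_zero`, as `θ₃_pow_four_mul` shows after
evaluation. -/
theorem conjMul_scaledOverlap : ∀ a b : Fin 6, (a, b) ≠ (0, 0) →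
    (conjMul (scaledOverlap a b) (scaledOverlap a b)).1 = .ofQuadInt
      ⟨⟨76147473748454277120, -38073736874227138560⟩,
        ⟨22844242124536283136, -15229494749690855424⟩⟩ := by
  decide +kernel

end Arithmetic
end SIC6
namespace SIC6
noncomputable section

/-! ### Transfer of formal identities to real numbers. -/

section Evaluation

variable {R : Type}

/-- The map `e` is compatible with addition, negation and multiplication. -/
structure IsEval [Add R] [Neg R] [Mul R] (e : R → ℝ) : Prop where
  add : ∀ x y, e (x + y) = e x + e y
  neg : ∀ x, e (-x) = -e x
  mul : ∀ x y, e (x * y) = e x * e y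

/-- The value of `re + im * α`. -/
def QuadExt.eval {d : R} (e : R → ℝ) (α : ℝ) (x : QuadExt R d) : ℝ := e x.re + e x.im * α

/-- The value of `c₀ + c₁ * α + c₂ * α ^ 2`. -/
def CubicExt.eval {p q : R} (e : R → ℝ) (α : ℝ) (x : CubicExt R p q) : ℝ :=
  e x.c₀ + e x.c₁ * α + e x.c₂ * α ^ 2

/-- Only the relation for α² matters: evaluation need not be injective, and no ring axioms on
coordinates are needed, since equal coordinates have equal values. -/
theorem QuadExt.isEval [Add R] [Neg R] [Mul R] {d : R} {e : R → ℝ} (h : IsEval e) {α : ℝ} (hα : α ^ 2 = e d) :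
    IsEval (QuadExt.eval (d := d) e α) where
  add x y := by
    change e (x.re + y.re) + e (x.im + y.im) * α = (e x.re + e x.im * α) + (e y.re + e y.im * α)
    rw [h.add, h.add]
    ring
  neg x := by
    change e (-x.re) + e (-x.im) * α = -(e x.re + e x.im * α)
    rw [h.neg, h.neg]
    ring
  mul x y := by
    change e (x.re * y.re + d * (x.im * y.im)) + e (x.re * y.im + x.im * y.re) * α =
      (e x.re + e x.im * α) * (e y.re + e y.im * α)
    simp only [h.add, h.mul]
    linear_combination -(e x.im * e y.im) * hα

theorem CubicExt.isEval [Add R] [Neg R] [Mul R] {p q : R} {e : R → ℝ} (h : IsEval e) {α : ℝ}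
    (hα : α ^ 3 = e p * α + e q) : IsEval (CubicExt.eval (p := p) (q := q) e α) where
  add x y := by
    change e (x.c₀ + y.c₀) + e (x.c₁ + y.c₁) * α + e (x.c₂ + y.c₂) * α ^ 2 =
      (e x.c₀ + e x.c₁ * α + e x.c₂ * α ^ 2) + (e y.c₀ + e y.c₁ * α + e y.c₂ * α ^ 2)
    simp only [h.add]
    ring
  neg x := by
    change e (-x.c₀) + e (-x.c₁) * α + e (-x.c₂) * α ^ 2 =
      -(e x.c₀ + e x.c₁ * α + e x.c₂ * α ^ 2)
    simp only [h.neg]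
    ring
  mul x y := by
    change e (x.c₀ * y.c₀ + q * (x.c₁ * y.c₂ + x.c₂ * y.c₁)) +
        e (x.c₀ * y.c₁ + x.c₁ * y.c₀ + p * (x.c₁ * y.c₂ + x.c₂ * y.c₁) +
          q * (x.c₂ * y.c₂)) * α +
        e (x.c₀ * y.c₂ + x.c₁ * y.c₁ + x.c₂ * y.c₀ + p * (x.c₂ * y.c₂)) * α ^ 2 =
      (e x.c₀ + e x.c₁ * α + e x.c₂ * α ^ 2) * (e y.c₀ + e y.c₁ * α + e y.c₂ * α ^ 2)
    simp only [h.add, h.mul]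
    linear_combination (-(e x.c₁ * e y.c₂ + e x.c₂ * e y.c₁) - e x.c₂ * e y.c₂ * α) * hα

theorem QuadExt.eval_map {d : R} {e : R → ℝ} {g : R → R} {c : ℝ} (h : ∀ x, e (g x) = c * e x)
    (α : ℝ) (x : QuadExt R d) : (x.map g).eval e α = c * x.eval e α := by
  simp only [QuadExt.eval, QuadExt.map, h]
  ring

theorem CubicExt.eval_map {p q : R} {e : R → ℝ} {g : R → R} {c : ℝ}
    (h : ∀ x, e (g x) = c * e x) (α : ℝ) (x : CubicExt R p q) :
    (x.map g).eval e α = c * x.eval e α := by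
  simp only [CubicExt.eval, CubicExt.map, h]
  ring

end Evaluation

/-! ### The embedding at √3, √7, θ₁, θ₂ and the normalization constants. -/

section Values

theorem sqrt_three_sq : √3 ^ 2 = (3 : ℝ) := Real.sq_sqrt (by norm_num)

theorem sqrt_seven_sq : √7 ^ 2 = (7 : ℝ) := Real.sq_sqrt (by norm_num)

theorem sqrt_twentyOne : √21 = √3 * (√7 : ℝ) := by
  rw [← Real.sqrt_mul (by norm_num)]
  norm_num

theorem θ₁_sq : θ₁ ^ 2 = (3 * √21 + 9) / 224 := Real.sq_sqrt (by positivity)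

theorem θ₃_sq : θ₃ ^ 2 = (3 * √21 + 3 * √7 + 7 * √3 + 21) / 48384 :=
  Real.sq_sqrt (by positivity)

/-- The embedding `ℤ[√3] → ℝ`. -/
def evalThree : QuadExt ℤ 3 → ℝ := QuadExt.eval (fun n : ℤ => (n : ℝ)) √3

/-- The embedding `ℤ[√3, √7] → ℝ`. -/
def QuadInt.eval : QuadInt → ℝ := QuadExt.eval evalThree √7

/-- The embedding `ℤ[√3, √7, 56 θ₁] → ℝ`. -/
def ThetaInt.eval : ThetaInt → ℝ := QuadExt.eval QuadInt.eval (56 * θ₁)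

/-- The embedding `ℤ[√3, √7, 56 θ₁, 84 θ₂] → ℝ`. -/
def RealInt.eval (θ₂ : ℝ) : RealInt → ℝ := CubicExt.eval ThetaInt.eval (84 * θ₂)

theorem isEval_evalThree : IsEval evalThree :=
  QuadExt.isEval ⟨fun x y => Int.cast_add x y, fun x => Int.cast_neg x,
    fun x y => Int.cast_mul x y⟩ (by rw [sqrt_three_sq]; norm_num)

theorem QuadInt.isEval : IsEval QuadInt.eval :=
  QuadExt.isEval isEval_evalThree (by
    rw [sqrt_seven_sq]
    simp [evalThree, QuadExt.eval])

theorem ThetaInt.isEval : IsEval ThetaInt.eval :=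
  QuadExt.isEval QuadInt.isEval (by
    rw [mul_pow, θ₁_sq, sqrt_twentyOne]
    simp only [QuadInt.eval, evalThree, QuadExt.eval]
    push_cast
    ring)

variable {θ₂ : ℝ}

theorem RealInt.isEval (hθ₂ : f θ₂ = 0) : IsEval (RealInt.eval θ₂) :=
  CubicExt.isEval ThetaInt.isEval (by
    rw [f, sqrt_twentyOne] at hθ₂
    simp only [ThetaInt.eval, QuadInt.eval, evalThree, QuadExt.eval]
    push_cast
    linear_combination 84 ^ 3 * hθ₂)

theorem RealInt.eval_scale (s : QuadExt ℤ 3) (y : RealInt) :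
    (RealInt.scale s y).eval θ₂ = evalThree s * y.eval θ₂ :=
  CubicExt.eval_map (QuadExt.eval_map (QuadExt.eval_map (isEval_evalThree.mul s) _) _) _ _

theorem RealInt.eval_ofQuadInt (y : QuadInt) :
    (RealInt.ofQuadInt y).eval θ₂ = QuadInt.eval y := by
  simp [RealInt.ofQuadInt, RealInt.eval, CubicExt.eval, ThetaInt.eval, QuadExt.eval,
    QuadInt.eval, evalThree]

/-- The complex number with the given real and imaginary parts. -/
def toComplex (θ₂ : ℝ) (z : RealInt × RealInt) : ℂ :=
  (z.1.eval θ₂ : ℂ) + (z.2.eval θ₂ : ℂ) * Complex.I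

theorem toComplex_add (hθ₂ : f θ₂ = 0) (z w : RealInt × RealInt) :
    toComplex θ₂ (z + w) = toComplex θ₂ z + toComplex θ₂ w := by
  simp only [toComplex, Prod.fst_add, Prod.snd_add, (RealInt.isEval hθ₂).add]
  push_cast
  ring

theorem toComplex_conjMul (hθ₂ : f θ₂ = 0) (z w : RealInt × RealInt) :
    toComplex θ₂ (conjMul z w) = star (toComplex θ₂ z) * toComplex θ₂ w := by
  simp only [toComplex, conjMul, (RealInt.isEval hθ₂).add, (RealInt.isEval hθ₂).mul,
    (RealInt.isEval hθ₂).neg, star_add, star_mul', Complex.star_def, Complex.conj_ofReal,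
    Complex.conj_I]
  push_cast
  linear_combination (z.2.eval θ₂ : ℂ) * (w.2.eval θ₂ : ℂ) * Complex.I_sq

theorem toComplex_complexScale (hθ₂ : f θ₂ = 0) (s : QuadExt ℤ 3 × QuadExt ℤ 3)
    (z : RealInt × RealInt) : toComplex θ₂ (RealInt.complexScale s z) =
      ((evalThree s.1 : ℂ) + (evalThree s.2 : ℂ) * Complex.I) * toComplex θ₂ z := by
  simp only [toComplex, RealInt.complexScale, (RealInt.isEval hθ₂).add, RealInt.eval_scale,
    isEval_evalThree.neg]
  push_cast
  linear_combination -(evalThree s.2 : ℂ) * (z.2.eval θ₂ : ℂ) * Complex.I_sq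

theorem normSq_toComplex (hθ₂ : f θ₂ = 0) (z : RealInt × RealInt) :
    ‖toComplex θ₂ z‖ ^ 2 = (conjMul z z).1.eval θ₂ := by
  rw [← Complex.normSq_eq_norm_sq, toComplex, Complex.normSq_add_mul_I]
  simp only [conjMul, (RealInt.isEval hθ₂).add, (RealInt.isEval hθ₂).mul]
  ring

theorem rootOfUnity_six : rootOfUnity 6 = 1 / 2 + (√3 : ℝ) / 2 * Complex.I := by
  have h : (2 * Real.pi * Complex.I / (6 : ℕ) : ℂ) = ((Real.pi / 3 : ℝ) : ℂ) * Complex.I := by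
    push_cast
    ring
  rw [rootOfUnity, h, Complex.exp_mul_I, ← Complex.ofReal_cos, ← Complex.ofReal_sin,
    Real.cos_pi_div_three, Real.sin_pi_div_three]
  push_cast
  ring

theorem rootOfUnity_pow_self (d : ℕ) [NeZero d] : rootOfUnity d ^ d = 1 := by
  rw [rootOfUnity, ← Complex.exp_nat_mul, mul_div_cancel₀ _ (Nat.cast_ne_zero.2 (NeZero.ne d)),
    Complex.exp_two_pi_mul_I]

theorem twiceRoot_eq (k : Fin 6) : (evalThree (twiceRoot k).1 : ℂ) +
    (evalThree (twiceRoot k).2 : ℂ) * Complex.I = 2 * rootOfUnity 6 ^ (k : ℕ) := by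
  have h3 : ((√3 : ℝ) : ℂ) ^ 2 = 3 := by
    rw [← Complex.ofReal_pow, sqrt_three_sq]
    norm_num
  have h2 : rootOfUnity 6 ^ 2 = rootOfUnity 6 - 1 := by
    rw [rootOfUnity_six]
    linear_combination (Complex.I ^ 2 / 4) * h3 + 3 / 4 * Complex.I_sq
  have h3' : rootOfUnity 6 ^ 3 = -1 := by
    linear_combination (rootOfUnity 6 + 1) * h2
  have h4 : rootOfUnity 6 ^ 4 = -rootOfUnity 6 := by
    linear_combination rootOfUnity 6 * h3'
  have h5 : rootOfUnity 6 ^ 5 = 1 - rootOfUnity 6 := by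
    linear_combination rootOfUnity 6 ^ 2 * h3' - h2
  fin_cases k <;> simp only [twiceRoot, evalThree, QuadExt.eval] <;>
    simp [h2, h3', h4, h5] <;> rw [rootOfUnity_six] <;> ring

/-- The vector `(v₁, …, v₆)`. -/
def vec (θ₂ : ℝ) : Fin 6 → ℂ := ![v₁ θ₂, v₂ θ₂, v₃, v₄ θ₂, v₅ θ₂, v₆]

theorem toComplex_scaledVec (θ₂ : ℝ) (j : Fin 6) :
    toComplex θ₂ (scaledVec j) = 1176 * vec θ₂ j := by
  fin_cases j <;>
    simp [scaledVec, vec, toComplex, v₁, v₂, v₃, v₄, v₅, v₆, RealInt.eval, ThetaInt.eval,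
      QuadInt.eval, evalThree, CubicExt.eval, QuadExt.eval, sqrt_twentyOne] <;> ring

theorem eval_θ₃_sq : QuadInt.eval ⟨⟨21, 7⟩, ⟨3, 3⟩⟩ = 48384 * θ₃ ^ 2 := by
  rw [θ₃_sq, sqrt_twentyOne]
  simp only [QuadInt.eval, evalThree, QuadExt.eval]
  push_cast
  ring

theorem QuadInt.eval_intCast (n : ℤ) : QuadInt.eval ⟨⟨n, 0⟩, ⟨0, 0⟩⟩ = n := by
  simp [QuadInt.eval, evalThree, QuadExt.eval]

theorem θ₃_sq_mul : θ₃ ^ 2 *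
    QuadInt.eval ⟨⟨16728477696, -5576159232⟩, ⟨2389782528, -2389782528⟩⟩ = 2 * 1176 ^ 2 := by
  -- The first factor is 48384 θ₃², and the product 133827821568 is 48384 · 2 · 1176².
  have h : (⟨⟨21, 7⟩, ⟨3, 3⟩⟩ * ⟨⟨16728477696, -5576159232⟩, ⟨2389782528, -2389782528⟩⟩ : QuadInt)
      = ⟨⟨133827821568, 0⟩, ⟨0, 0⟩⟩ := by decide +kernel
  have h' := congrArg QuadInt.eval h
  rw [QuadInt.isEval.mul, eval_θ₃_sq, QuadInt.eval_intCast] at h'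
  push_cast at h'
  linear_combination h' / 48384

theorem θ₃_pow_four_mul : θ₃ ^ 4 *
    QuadInt.eval ⟨⟨76147473748454277120, -38073736874227138560⟩,
      ⟨22844242124536283136, -15229494749690855424⟩⟩ = (2 * 1176 ^ 2) ^ 2 / 7 := by
  -- The integer on the right is 48384² · (2 · 1176²)² / 7.
  have h : (⟨⟨21, 7⟩, ⟨3, 3⟩⟩ * ⟨⟨21, 7⟩, ⟨3, 3⟩⟩ *
      ⟨⟨76147473748454277120, -38073736874227138560⟩,
        ⟨22844242124536283136, -15229494749690855424⟩⟩ : QuadInt)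
      = ⟨⟨2558555117948063711232, 0⟩, ⟨0, 0⟩⟩ := by decide +kernel
  have h' := congrArg QuadInt.eval h
  rw [QuadInt.isEval.mul, QuadInt.isEval.mul, eval_θ₃_sq, QuadInt.eval_intCast] at h'
  push_cast at h'
  linear_combination h' / 48384 ^ 2

end Values

end

end SIC6
namespace SIC6
open Matrix

/-! ### Overlaps of the fiducial vector with its displacements. -/

section Overlaps

theorem shiftX_pow_mulVec (d : ℕ) [NeZero d] (a : ℕ) (ψ : Fin d → ℂ) (k : Fin d) :
    ((shiftX d ^ a).mulVec ψ) (k + Fin.ofNat d a) = ψ k := by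
  induction a generalizing k with
  | zero => simp
  | succ a ih =>
    have h : k + Fin.ofNat d (a + 1) = k + Fin.ofNat d a + 1 := by
      rw [add_assoc]
      congr 1
      ext
      simp [Fin.val_add, Fin.ofNat]
    rw [h, pow_succ', ← Matrix.mulVec_mulVec, Matrix.mulVec, dotProduct,
      Finset.sum_eq_single (k + Fin.ofNat d a), ih]
    · simp [shiftX]
    · intro j _ hj
      rw [shiftX, Matrix.of_apply, if_neg fun h => hj (add_right_cancel h).symm, zero_mul]
    · simp

theorem phaseZ_pow_mulVec (d b : ℕ) (ψ : Fin d → ℂ) (k : Fin d) :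
    ((phaseZ d ^ b).mulVec ψ) k = rootOfUnity d ^ ((k : ℕ) * b) * ψ k := by
  rw [phaseZ, Matrix.diagonal_pow, Matrix.mulVec_diagonal, Pi.pow_apply, pow_mul]

/-- Reindexing by j ↦ j + a undoes the shift. The exponent is reduced modulo d so that, for d = 6,
it can index the table `twiceRoot`. -/
theorem overlap_eq_sum (d : ℕ) [NeZero d] (a b : Fin d) (ψ : Fin d → ℂ) :
    star ψ ⬝ᵥ ((shiftX d ^ (a : ℕ) * phaseZ d ^ (b : ℕ)).mulVec ψ) =
      ∑ j, rootOfUnity d ^ ((b * j : Fin d) : ℕ) * (star (ψ (j + a)) * ψ j) := by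
  rw [dotProduct, ← Equiv.sum_comp (Equiv.addRight a)]
  refine Finset.sum_congr rfl fun j _ => ?_
  have h := shiftX_pow_mulVec d a ((phaseZ d ^ (b : ℕ)).mulVec ψ) j
  rw [Fin.ofNat_val_eq_self] at h
  rw [Equiv.coe_addRight, ← Matrix.mulVec_mulVec, Pi.star_apply, h, phaseZ_pow_mulVec, Fin.val_mul,
    ← pow_eq_pow_mod _ (rootOfUnity_pow_self d), mul_comm (b : ℕ)]
  ring

variable {θ₂ : ℝ}

theorem toComplex_scaledOverlap (hθ₂ : f θ₂ = 0) (a b : Fin 6) :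
    toComplex θ₂ (scaledOverlap a b) = 2 * 1176 ^ 2 *
      (star (vec θ₂) ⬝ᵥ ((shiftX 6 ^ (a : ℕ) * phaseZ 6 ^ (b : ℕ)).mulVec (vec θ₂))) := by
  rw [overlap_eq_sum, Finset.mul_sum, Fin.sum_univ_six, scaledOverlap]
  simp only [toComplex_add hθ₂, toComplex_complexScale hθ₂, toComplex_conjMul hθ₂,
    toComplex_scaledVec, twiceRoot_eq, star_mul', star_ofNat]
  ring

theorem φ₀_overlap (a b : Fin 6) :
    star (φ₀ θ₂) ⬝ᵥ ((shiftX 6 ^ (a : ℕ) * phaseZ 6 ^ (b : ℕ)).mulVec (φ₀ θ₂)) =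
      ((θ₃ ^ 2 : ℝ) : ℂ) *
        (star (vec θ₂) ⬝ᵥ ((shiftX 6 ^ (a : ℕ) * phaseZ 6 ^ (b : ℕ)).mulVec (vec θ₂))) := by
  rw [show φ₀ θ₂ = (θ₃ : ℂ) • vec θ₂ from rfl, Matrix.mulVec_smul, star_smul, dotProduct_smul,
    smul_dotProduct, Complex.star_def, Complex.conj_ofReal, smul_smul, smul_eq_mul]
  push_cast
  ring

theorem φ₀_dotProduct_self (hθ₂ : f θ₂ = 0) : star (φ₀ θ₂) ⬝ᵥ φ₀ θ₂ = 1 := by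
  have h := φ₀_overlap (θ₂ := θ₂) 0 0
  have h' := toComplex_scaledOverlap hθ₂ 0 0
  have h3 : ((θ₃ ^ 2 : ℝ) : ℂ) * toComplex θ₂ (scaledOverlap 0 0) = 2 * 1176 ^ 2 := by
    rw [scaledOverlap_zero]
    simp only [toComplex, RealInt.eval_ofQuadInt]
    rw [QuadInt.eval_intCast, Int.cast_zero, Complex.ofReal_zero, zero_mul, add_zero,
      ← Complex.ofReal_mul, θ₃_sq_mul]
    norm_num
  rw [h'] at h3
  simp only [Fin.val_zero, pow_zero, one_mul, Matrix.one_mulVec] at h h3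
  rw [h]
  linear_combination h3 / (2 * 1176 ^ 2)

theorem norm_φ₀_overlap_sq (hθ₂ : f θ₂ = 0) (a b : Fin 6) (hab : (a, b) ≠ (0, 0)) :
    ‖star (φ₀ θ₂) ⬝ᵥ
      ((shiftX 6 ^ (a : ℕ) * phaseZ 6 ^ (b : ℕ)).mulVec (φ₀ θ₂))‖ ^ 2 = 1 / 7 := by
  have h := normSq_toComplex hθ₂ (scaledOverlap a b)
  rw [conjMul_scaledOverlap a b hab, RealInt.eval_ofQuadInt, toComplex_scaledOverlap hθ₂] at h
  have h4 := θ₃_pow_four_mul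
  rw [← h, norm_mul] at h4
  rw [φ₀_overlap, norm_mul, Complex.norm_real, Real.norm_of_nonneg (sq_nonneg _)]
  norm_num at h4 ⊢
  linear_combination h4 / (2 * 1176 ^ 2) ^ 2

end Overlaps

end SIC6
namespace SIC6
open Matrix
open scoped ComplexOrder

/-! ### Equiangular families of d² vectors form SIC-POVMs. -/

section EquiangularProjectors

variable {d : ℕ} {ι : Type*}

theorem trace_ketBra_mul_ketBra (φ ψ : Fin d → ℂ) :
    (ketBra φ * ketBra ψ).trace = ((‖star φ ⬝ᵥ ψ‖ ^ 2 : ℝ) : ℂ) := by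
  have h' : φ ⬝ᵥ star ψ = star (star φ ⬝ᵥ ψ) := by
    rw [star_dotProduct, star_star, dotProduct_comm]
  rw [ketBra, ketBra, vecMulVec_mul_vecMulVec, trace_vecMulVec, dotProduct_smul, h', smul_eq_mul, Complex.star_def, Complex.mul_conj, Complex.normSq_eq_norm_sq]

theorem isHermitian_ketBra (φ : Fin d → ℂ) : (ketBra φ).IsHermitian := by
  rw [IsHermitian, ketBra, conjTranspose_vecMulVec, star_star]

theorem mul_star_of_norm_eq_one {c : ℂ} (hc : ‖c‖ = 1) : c * star c = 1 := by
  rw [Complex.star_def, Complex.mul_conj, Complex.normSq_eq_norm_sq, hc]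
  norm_num

theorem ketBra_smul {c : ℂ} (hc : ‖c‖ = 1) (φ : Fin d → ℂ) : ketBra (c • φ) = ketBra φ := by
  rw [ketBra, star_smul, smul_vecMulVec, vecMulVec_smul, smul_smul, mul_star_of_norm_eq_one hc,
    one_smul, ketBra]

theorem mul_ketBra_mul_star (U : Matrix (Fin d) (Fin d) ℂ) (φ : Fin d → ℂ) :
    U * ketBra φ * star U = ketBra (U.mulVec φ) := by
  rw [ketBra, ketBra, mul_vecMulVec, vecMulVec_mul, star_mulVec, star_eq_conjTranspose]

variable {ψ : ι → Fin d → ℂ}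

theorem trace_ketBra_mul_ketBra_of_equiangular [DecidableEq ι] (hψ : ∀ i, star (ψ i) ⬝ᵥ ψ i = 1)
    (hov : ∀ i j, i ≠ j → ‖star (ψ i) ⬝ᵥ ψ j‖ ^ 2 = 1 / ((d : ℝ) + 1)) (i j : ι) :
    (ketBra (ψ i) * ketBra (ψ j)).trace =
      (if i = j then (d : ℂ) / (d + 1) else 0) + 1 / ((d : ℂ) + 1) := by
  have hd : ((d : ℂ) + 1) ≠ 0 := Nat.cast_add_one_ne_zero d
  rw [trace_ketBra_mul_ketBra]
  split_ifs with h
  · subst h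
    rw [hψ]
    field_simp
    simp
  · rw [hov i j h]
    push_cast
    ring

/-- The Gram matrix (d I + J)/(d + 1) is invertible: tracing a relation against each projector gives
d c_j + ∑ c = 0, and summing over the d² indices forces ∑ c = 0. -/
theorem linearIndependent_ketBra_of_equiangular [Fintype ι] [NeZero d] (hcard : Fintype.card ι = d ^ 2)
    (hψ : ∀ i, star (ψ i) ⬝ᵥ ψ i = 1)
    (hov : ∀ i j, i ≠ j → ‖star (ψ i) ⬝ᵥ ψ j‖ ^ 2 = 1 / ((d : ℝ) + 1)) :
    LinearIndependent ℂ fun i => ketBra (ψ i) := by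
  classical
  have hd : (d : ℂ) ≠ 0 := Nat.cast_ne_zero.2 (NeZero.ne d)
  have hd1 : ((d : ℂ) + 1) ≠ 0 := Nat.cast_add_one_ne_zero d
  rw [Fintype.linearIndependent_iff]
  intro c hc
  have key : ∀ j, (d : ℂ) * c j + ∑ i, c i = 0 := by
    intro j
    have h : ((∑ i, c i • ketBra (ψ i)) * ketBra (ψ j)).trace = 0 := by simp [hc]
    simp only [Finset.sum_mul, trace_sum, smul_mul_assoc, trace_smul,
      trace_ketBra_mul_ketBra_of_equiangular hψ hov, smul_eq_mul, mul_add, mul_ite, mul_zero,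
      Finset.sum_add_distrib, Finset.sum_ite_eq', Finset.mem_univ, if_true] at h
    rw [← Finset.sum_mul] at h
    field_simp at h
    linear_combination h
  have hsum : (d : ℂ) * ((d : ℂ) + 1) * ∑ i, c i = 0 := by
    have h : ∑ j, ((d : ℂ) * c j + ∑ i, c i) = 0 := Finset.sum_eq_zero fun j _ => key j
    rw [Finset.sum_add_distrib, ← Finset.mul_sum, Finset.sum_const, Finset.card_univ, hcard] at h
    rw [nsmul_eq_mul] at h
    push_cast at h
    linear_combination h
  have hzero : ∑ i, c i = 0 := by simpa [hd, hd1] using hsum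
  intro j
  simpa [hzero, hd] using key j

/-- The sum S is Hermitian with tr S = tr S² = d, so S - 1 has Hilbert–Schmidt norm d - 2d + d = 0.
-/
theorem sum_ketBra_of_equiangular [Fintype ι] [NeZero d] (hcard : Fintype.card ι = d ^ 2)
    (hψ : ∀ i, star (ψ i) ⬝ᵥ ψ i = 1)
    (hov : ∀ i j, i ≠ j → ‖star (ψ i) ⬝ᵥ ψ j‖ ^ 2 = 1 / ((d : ℝ) + 1)) :
    ∑ i, (d : ℂ)⁻¹ • ketBra (ψ i) = 1 := by
  classical
  have hd : (d : ℂ) ≠ 0 := Nat.cast_ne_zero.2 (NeZero.ne d)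
  have hd1 : ((d : ℂ) + 1) ≠ 0 := Nat.cast_add_one_ne_zero d
  set S := ∑ i, (d : ℂ)⁻¹ • ketBra (ψ i) with hS
  have hherm : Sᴴ = S := by
    simp only [hS, conjTranspose_sum, conjTranspose_smul, (isHermitian_ketBra _).eq]
    simp
  have htr : S.trace = d := by
    have h : ∀ i, (ketBra (ψ i)).trace = 1 := fun i => by
      rw [ketBra, trace_vecMulVec, dotProduct_comm, hψ]
    simp only [hS, trace_sum, trace_smul, h, Finset.sum_const, Finset.card_univ, hcard,
      nsmul_eq_mul, smul_eq_mul]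
    push_cast
    field_simp
  have htr2 : (S * S).trace = d := by
    simp only [hS, Finset.sum_mul, Finset.mul_sum, trace_sum, smul_mul_assoc, mul_smul_comm,
      trace_smul, trace_ketBra_mul_ketBra_of_equiangular hψ hov, smul_eq_mul, mul_add, mul_ite,
      mul_zero, Finset.sum_add_distrib, Finset.sum_ite_eq', Finset.mem_univ,
      if_true, Finset.sum_const, Finset.card_univ, hcard, nsmul_eq_mul]
    push_cast
    field_simp
    ring
  have h0 : ((S - 1)ᴴ * (S - 1)).trace = 0 := by
    rw [conjTranspose_sub, hherm, conjTranspose_one, sub_mul, mul_sub, mul_sub]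
    simp only [mul_one, one_mul, trace_sub, htr, htr2, trace_one, Fintype.card_fin]
    ring
  exact sub_eq_zero.1 (trace_conjTranspose_mul_self_eq_zero_iff.1 h0)

/-- A family of `d ^ 2` normalized vectors with `‖⟨ψ|ψ'⟩‖ ^ 2 = 1 / (d + 1)` gives a SIC-POVM. -/
theorem isSICPOVM_of_equiangular [Fintype ι] [NeZero d] (hcard : Fintype.card ι = d ^ 2)
    (hψ : ∀ i, star (ψ i) ⬝ᵥ ψ i = 1)
    (hov : ∀ i j, i ≠ j → ‖star (ψ i) ⬝ᵥ ψ j‖ ^ 2 = 1 / ((d : ℝ) + 1)) :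
    IsSICPOVM (Set.range fun i => (d : ℂ)⁻¹ • ketBra (ψ i)) := by
  classical
  have hd : (d : ℂ) ≠ 0 := Nat.cast_ne_zero.2 (NeZero.ne d)
  have hli := linearIndependent_ketBra_of_equiangular hcard hψ hov
  have hinj : Function.Injective fun i => (d : ℂ)⁻¹ • ketBra (ψ i) :=
    (smul_right_injective _ (inv_ne_zero hd)).comp hli.injective
  have hspan : Submodule.span ℂ (Set.range fun i => ketBra (ψ i)) = ⊤ := by
    refine hli.span_eq_top_of_card_eq_finrank' ?_
    rw [hcard, Module.finrank_matrix, Module.finrank_self, Fintype.card_fin, mul_one, sq]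
  refine ⟨⟨Set.finite_range _, ?_, ?_⟩, ?_, ?_, ?_, ?_⟩
  · rintro _ ⟨i, rfl⟩
    have h : (0 : ℂ) ≤ (d : ℂ)⁻¹ := by
      rw [inv_nonneg]
      exact Nat.cast_nonneg d
    exact (posSemidef_vecMulVec_self_star (ψ i)).smul h
  · rw [Set.Finite.toFinset_range, Finset.sum_image hinj.injOn]
    exact sum_ketBra_of_equiangular hcard hψ hov
  · intro ρ σ _ _ _ _ h
    -- Equal statistics extend linearly from the spanning projectors to every M; then M = (ρ - σ)ᴴ
    -- gives ρ = σ.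
    have h0 : ∀ M : Matrix (Fin d) (Fin d) ℂ, (M * (ρ - σ)).trace = 0 := by
      intro M
      have hM : M ∈ Submodule.span ℂ (Set.range fun i => ketBra (ψ i)) := hspan ▸ Submodule.mem_top
      induction hM using Submodule.span_induction with
      | mem M hM =>
        obtain ⟨i, rfl⟩ := hM
        have h' := h _ ⟨i, rfl⟩
        simp only [smul_mul_assoc, trace_smul, smul_eq_mul] at h'
        rw [mul_sub, trace_sub, mul_left_cancel₀ (inv_ne_zero hd) h', sub_self]
      | zero => simp
      | add M N _ _ hM hN => rw [add_mul, trace_add, hM, hN, add_zero]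
      | smul c M _ hM => rw [smul_mul_assoc, trace_smul, hM, smul_zero]
    exact sub_eq_zero.1 (trace_conjTranspose_mul_self_eq_zero_iff.1 (h0 _))
  · rw [← Set.image_univ, Set.ncard_image_of_injective _ hinj, Set.ncard_univ,
      Nat.card_eq_fintype_card, hcard]
  · rintro _ ⟨i, rfl⟩
    exact ⟨ψ i, hψ i, smul_inv_smul₀ hd _⟩
  · rintro _ ⟨i, rfl⟩ _ ⟨j, rfl⟩ hij
    have h : i ≠ j := fun h => hij (h ▸ rfl)
    simp only [smul_inv_smul₀ hd]
    rw [trace_ketBra_mul_ketBra_of_equiangular hψ hov, if_neg h, zero_add]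

end EquiangularProjectors

/-! ### The Heisenberg group modulo phases and its orbits. -/

section HeisenbergOrbit

variable (d : ℕ) [NeZero d]

theorem shiftX_pow_self : shiftX d ^ d = 1 := by
  refine Matrix.ext_iff_mulVec.2 fun ψ => ?_
  ext k
  have h := shiftX_pow_mulVec d d ψ k
  have h0 : Fin.ofNat d d = 0 := by
    ext
    simp [Fin.ofNat]
  rw [one_mulVec]
  rwa [h0, add_zero] at h

theorem phaseZ_pow_self : phaseZ d ^ d = 1 := by
  rw [phaseZ, diagonal_pow, ← diagonal_one]
  congr 1
  ext j
  rw [Pi.pow_apply, ← pow_mul, mul_comm, pow_mul, rootOfUnity_pow_self, one_pow]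

theorem norm_rootOfUnity : ‖rootOfUnity d‖ = 1 :=
  Complex.norm_eq_one_of_pow_eq_one (rootOfUnity_pow_self d) (NeZero.ne d)

theorem shiftX_mem_unitary : shiftX d ∈ unitary (Matrix (Fin d) (Fin d) ℂ) := by
  refine mem_unitaryGroup_iff.2 ?_
  ext a b
  rw [mul_apply, Finset.sum_eq_single (a - 1)]
  · by_cases h : a = b
    · simp [shiftX, h, one_apply]
    · simp [shiftX, h, Ne.symm h]
  · intro j _ hj
    have : a ≠ j + 1 := fun h => hj (by simp [h])
    simp [shiftX, this]
  · simp

theorem phaseZ_mem_unitary : phaseZ d ∈ unitary (Matrix (Fin d) (Fin d) ℂ) := by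
  refine mem_unitaryGroup_iff.2 ?_
  rw [phaseZ, star_eq_conjTranspose, diagonal_conjTranspose, diagonal_mul_diagonal, ← diagonal_one]
  congr 1
  ext j
  refine mul_star_of_norm_eq_one ?_
  rw [norm_pow, norm_rootOfUnity, one_pow]

theorem phaseZ_mul_shiftX :
    phaseZ d * shiftX d = rootOfUnity d • (shiftX d * phaseZ d) := by
  ext k j
  rw [phaseZ, diagonal_mul, Matrix.smul_apply, mul_diagonal, shiftX, of_apply]
  split_ifs with h
  · rw [h, Fin.val_add, ← pow_eq_pow_mod _ (rootOfUnity_pow_self d), pow_add, Fin.val_one',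
      ← pow_eq_pow_mod _ (rootOfUnity_pow_self d), smul_eq_mul]
    ring
  · simp

theorem phaseZ_pow_mul_shiftX_pow (b a : ℕ) : phaseZ d ^ b * shiftX d ^ a =
    rootOfUnity d ^ (b * a) • (shiftX d ^ a * phaseZ d ^ b) := by
  have h1 : ∀ b, phaseZ d ^ b * shiftX d = rootOfUnity d ^ b • (shiftX d * phaseZ d ^ b) := by
    intro b
    induction b with
    | zero => simp
    | succ b ih =>
      rw [pow_succ', mul_assoc, ih, mul_smul_comm, ← mul_assoc, phaseZ_mul_shiftX, smul_mul_assoc,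
        smul_smul, mul_assoc, ← pow_succ, ← pow_succ']
  induction a with
  | zero => simp
  | succ a ih =>
    rw [pow_succ, ← mul_assoc, ih, smul_mul_assoc, mul_assoc, h1, mul_smul_comm, smul_smul,
      ← mul_assoc, ← pow_add]
    congr 2

/-- The displacement operator `X ^ a Z ^ b`. -/
noncomputable def displacement (a b : ℕ) : Matrix (Fin d) (Fin d) ℂ := shiftX d ^ a * phaseZ d ^ b

theorem displacement_mod (a b : ℕ) : displacement d a b = displacement d (a % d) (b % d) := by
  rw [displacement, displacement, ← pow_eq_pow_mod _ (shiftX_pow_self d),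
    ← pow_eq_pow_mod _ (phaseZ_pow_self d)]

theorem displacement_mem_unitary (a b : ℕ) :
    displacement d a b ∈ unitary (Matrix (Fin d) (Fin d) ℂ) :=
  mul_mem (pow_mem (shiftX_mem_unitary d) a) (pow_mem (phaseZ_mem_unitary d) b)

theorem displacement_mul (a b k l : ℕ) : displacement d a b * displacement d k l =
    rootOfUnity d ^ (b * k) • displacement d (a + k) (b + l) := by
  rw [displacement, displacement, displacement, mul_assoc, ← mul_assoc (phaseZ d ^ b),
    phaseZ_pow_mul_shiftX_pow, smul_mul_assoc, mul_smul_comm, pow_add, pow_add]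
  simp only [mul_assoc]

theorem norm_rootOfUnity_pow (n : ℕ) : ‖rootOfUnity d ^ n‖ = 1 := by
  rw [norm_pow, norm_rootOfUnity, one_pow]

/-- The commutation rule ZX = ω XZ only produces phases, so displacements up to phase are closed
under products and inverses. -/
theorem exists_eq_smul_displacement {h : GL (Fin d) ℂ} (hh : h ∈ heisenbergGroup d) :
    ∃ (a b : ℕ) (c : ℂ), ‖c‖ = 1 ∧
      (h : Matrix (Fin d) (Fin d) ℂ) = c • displacement d a b := by
  induction hh using Subgroup.closure_induction with
  | mem g hg =>
    rcases hg with rfl | rfl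
    · exact ⟨1, 0, 1, norm_one, by simp [displacement]⟩
    · exact ⟨0, 1, 1, norm_one, by simp [displacement]⟩
  | one => exact ⟨0, 0, 1, norm_one, by simp [displacement]⟩
  | mul g g' _ _ hg hg' =>
    obtain ⟨a, b, c, hc, h⟩ := hg
    obtain ⟨a', b', c', hc', h'⟩ := hg'
    refine ⟨a + a', b + b', c * c' * rootOfUnity d ^ (b * a'), ?_, ?_⟩
    · rw [norm_mul, norm_mul, hc, hc', norm_rootOfUnity_pow, one_mul, one_mul]
    · rw [Units.val_mul, h, h', smul_mul_smul_comm, displacement_mul, smul_smul]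
  | inv g _ hg =>
    obtain ⟨a, b, c, hc, h⟩ := hg
    -- With m = d - 1 ≡ -1 modulo d, the exponents m a and m b stand for -a and -b while remaining
    -- natural numbers.
    obtain ⟨m, hm⟩ : ∃ m, m + 1 = d := ⟨d - 1, Nat.succ_pred_eq_of_ne_zero (NeZero.ne d)⟩
    have hz : ∀ n, (n + m * n) % d = 0 := fun n => by
      rw [show n + m * n = d * n by rw [← hm]; ring, Nat.mul_mod_right]
    have hne : c * rootOfUnity d ^ (b * (m * a)) ≠ 0 := by
      rw [← norm_ne_zero_iff, norm_mul, hc, norm_rootOfUnity_pow]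
      norm_num
    refine ⟨m * a, m * b, (c * rootOfUnity d ^ (b * (m * a)))⁻¹, ?_, ?_⟩
    · rw [norm_inv, norm_mul, hc, norm_rootOfUnity_pow]
      norm_num
    · refine Units.inv_eq_of_mul_eq_one_right ?_
      rw [h, smul_mul_smul_comm, displacement_mul, displacement_mod, hz, hz, smul_smul,
        mul_right_comm, mul_inv_cancel₀ hne]
      simp [displacement]

variable {d}

theorem conj_ketBra_of_eq_smul_displacement {h : GL (Fin d) ℂ} {a b : ℕ} {c : ℂ} (hc : ‖c‖ = 1)
    (hh : (h : Matrix (Fin d) (Fin d) ℂ) = c • displacement d a b) (s : ℂ) (φ : Fin d → ℂ) :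
    (h : Matrix (Fin d) (Fin d) ℂ) * (s • ketBra φ) *
      ((h⁻¹ : GL (Fin d) ℂ) : Matrix (Fin d) (Fin d) ℂ) =
        s • ketBra ((displacement d a b).mulVec φ) := by
  have hinv : ((h⁻¹ : GL (Fin d) ℂ) : Matrix (Fin d) (Fin d) ℂ) =
      star (c • displacement d a b) := by
    refine Units.inv_eq_of_mul_eq_one_right ?_
    rw [hh, star_smul, smul_mul_smul_comm, mul_star_of_norm_eq_one hc, one_smul]
    exact Unitary.mul_star_self_of_mem (displacement_mem_unitary d a b)
  rw [hinv, hh, mul_smul_comm, smul_mul_assoc, mul_ketBra_mul_star, smul_mulVec, ketBra_smul hc]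

theorem heisenbergOrbit_smul_ketBra (s : ℂ) (φ : Fin d → ℂ) :
    heisenbergOrbit d (s • ketBra φ) = Set.range fun p : Fin d × Fin d =>
      s • ketBra ((displacement d p.1 p.2).mulVec φ) := by
  ext F
  constructor
  · rintro ⟨h, hh, rfl⟩
    obtain ⟨a, b, c, hc, habc⟩ := exists_eq_smul_displacement d hh
    refine ⟨(Fin.ofNat d a, Fin.ofNat d b), ?_⟩
    rw [conj_ketBra_of_eq_smul_displacement hc habc, displacement_mod d a b]
    rfl
  · rintro ⟨⟨a, b⟩, rfl⟩
    refine ⟨(isUnit_shiftX d).unit ^ (a : ℕ) * (isUnit_phaseZ d).unit ^ (b : ℕ),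
      mul_mem (pow_mem (Subgroup.subset_closure (by simp)) _)
        (pow_mem (Subgroup.subset_closure (by simp)) _), ?_⟩
    refine (conj_ketBra_of_eq_smul_displacement (a := a) (b := b) norm_one ?_ s φ).symm
    simp [displacement]

/-- Displacement by q is, up to a phase, displacement by q - p followed by displacement by p, and
the latter is unitary. -/
theorem norm_displaced_overlap (φ : Fin d → ℂ) (p q : Fin d × Fin d) :
    ‖star ((displacement d p.1 p.2).mulVec φ) ⬝ᵥ (displacement d q.1 q.2).mulVec φ‖ =
      ‖star φ ⬝ᵥ (displacement d (q.1 - p.1 : Fin d) (q.2 - p.2 : Fin d)).mulVec φ‖ := by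
  set k := q.1 - p.1 with hk
  set l := q.2 - p.2 with hl
  have hq1 : (q.1 : ℕ) = (p.1 + k) % d := by rw [← Fin.val_add, hk, add_sub_cancel]
  have hq2 : (q.2 : ℕ) = (p.2 + l) % d := by rw [← Fin.val_add, hl, add_sub_cancel]
  have h : displacement d p.1 p.2 * displacement d k l =
      rootOfUnity d ^ ((p.2 : ℕ) * k) • displacement d q.1 q.2 := by
    rw [displacement_mul, displacement_mod, hq1, hq2]
  have hU : (displacement d p.1 p.2)ᴴ * displacement d p.1 p.2 = 1 :=
    Unitary.star_mul_self_of_mem (displacement_mem_unitary d p.1 p.2)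
  calc _ = ‖star ((displacement d p.1 p.2).mulVec φ) ⬝ᵥ
        (rootOfUnity d ^ ((p.2 : ℕ) * k) • displacement d q.1 q.2).mulVec φ‖ := by
        rw [smul_mulVec, dotProduct_smul, smul_eq_mul, norm_mul, norm_rootOfUnity_pow, one_mul]
    _ = _ := by
        rw [← h, ← mulVec_mulVec, star_mulVec, ← dotProduct_mulVec, mulVec_mulVec, hU, one_mulVec]

/-- A normalized vector with `‖⟨φ|X ^ a Z ^ b φ⟩‖ ^ 2 = 1 / (d + 1)` is a fiducial vector. -/
theorem isHeisenbergFiducial_of_overlaps {φ : Fin d → ℂ} (h1 : star φ ⬝ᵥ φ = 1)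
    (h : ∀ a b : Fin d, (a, b) ≠ (0, 0) →
      ‖star φ ⬝ᵥ (displacement d a b).mulVec φ‖ ^ 2 = 1 / ((d : ℝ) + 1)) :
    IsHeisenbergFiducial d φ := by
  refine ⟨h1, ?_⟩
  rw [heisenbergOrbit_smul_ketBra]
  refine isSICPOVM_of_equiangular ?_ ?_ ?_
  · rw [Fintype.card_prod, Fintype.card_fin, sq]
  · intro p
    have hU : (displacement d p.1 p.2)ᴴ * displacement d p.1 p.2 = 1 :=
      Unitary.star_mul_self_of_mem (displacement_mem_unitary d p.1 p.2)
    rw [star_mulVec, ← dotProduct_mulVec, mulVec_mulVec, hU, one_mulVec, h1]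
  · intro p q hpq
    rw [norm_displaced_overlap]
    refine h _ _ fun h0 => hpq ?_
    rw [Prod.mk.injEq, sub_eq_zero, sub_eq_zero] at h0
    exact (Prod.ext h0.1 h0.2).symm

end HeisenbergOrbit

end SIC6
namespace SIC6

/-! ### Degrees, squares and cubic roots in simple extensions. -/

section Tower

open Polynomial IntermediateField

variable {F E : Type*} [Field F] [Field E] [Algebra F E]

/-- The field `k(α)`, as an extension of `F`. -/
def adjoinOver (k : IntermediateField F E) (α : E) : IntermediateField F E :=
  (IntermediateField.adjoin k {α}).restrictScalars F

variable {k : IntermediateField F E} {α : E}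

theorem adjoinOver_eq_sup : adjoinOver k α = k ⊔ IntermediateField.adjoin F {α} :=
  IntermediateField.restrictScalars_adjoin_eq_sup F k {α}

theorem le_adjoinOver : k ≤ adjoinOver k α := adjoinOver_eq_sup (k := k) ▸ le_sup_left

theorem mem_adjoinOver : α ∈ adjoinOver k α :=
  adjoinOver_eq_sup (k := k) ▸ (le_sup_right (a := k)) (mem_adjoin_simple_self F α)

theorem adjoinOver_le {L : IntermediateField F E} (hk : k ≤ L) (hα : α ∈ L) :
    adjoinOver k α ≤ L := by
  rw [adjoinOver_eq_sup]
  exact sup_le hk (adjoin_simple_le_iff.2 hα)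

/-- In degree at most 3, absence of roots already gives irreducibility, so p is the minimal
polynomial of α. -/
theorem finrank_adjoinOver {p : k[X]} (hp : p.Monic) (hdeg : p.natDegree ∈ Finset.Icc 1 3)
    (hroot : ∀ x : k, p.eval x ≠ 0) (hα : aeval α p = 0) :
    Module.finrank F (adjoinOver k α) = Module.finrank F k * p.natDegree := by
  have hirr : Irreducible p :=
    irreducible_of_degree_le_three_of_not_isRoot hdeg fun x hx => hroot x hx
  have hint : IsIntegral k α := ⟨p, hp, hα⟩
  rw [minpoly.eq_of_irreducible_of_monic hirr hα hp, ← adjoin.finrank hint]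
  exact (Module.finrank_mul_finrank F k (IntermediateField.adjoin k {α})).symm

theorem finrank_adjoinOver_sqrt (hα2 : α ^ 2 ∈ k) (hα : α ∉ k) :
    Module.finrank F (adjoinOver k α) = Module.finrank F k * 2 := by
  have hdeg : (X ^ 2 - C (⟨α ^ 2, hα2⟩ : k)).natDegree = 2 := natDegree_X_pow_sub_C
  rw [finrank_adjoinOver (monic_X_pow_sub_C _ two_ne_zero) (by rw [hdeg]; decide), hdeg]
  · intro x hx
    have hx' : (x : E) ^ 2 = α ^ 2 := by
      rw [eval_sub, eval_pow, eval_X, eval_C, sub_eq_zero] at hx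
      exact congrArg Subtype.val hx
    rcases sq_eq_sq_iff_eq_or_eq_neg.1 hx' with h | h
    · exact hα (h ▸ x.2)
    · exact hα (neg_mem_iff.1 (h ▸ x.2))
  · simp [IntermediateField.algebraMap_apply]

theorem exists_eq_add_mul (hα2 : α ^ 2 ∈ k) {x : E} (hx : x ∈ adjoinOver k α) :
    ∃ a ∈ k, ∃ b ∈ k, x = a + b * α := by
  have hmonic : (X ^ 2 - C (⟨α ^ 2, hα2⟩ : k)).Monic := monic_X_pow_sub_C _ two_ne_zero
  have hroot : aeval α (X ^ 2 - C (⟨α ^ 2, hα2⟩ : k)) = 0 := by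
    simp [IntermediateField.algebraMap_apply]
  have hx' : x ∈ (IntermediateField.adjoin k {α}).toSubalgebra := hx
  rw [adjoin_simple_toSubalgebra_of_isAlgebraic
    (IsIntegral.isAlgebraic ⟨_, hmonic, hroot⟩), Algebra.adjoin_singleton_eq_range_aeval] at hx'
  obtain ⟨q, rfl⟩ := hx'
  have hlt : (q %ₘ (X ^ 2 - C (⟨α ^ 2, hα2⟩ : k))).natDegree < 2 := by
    have h := natDegree_modByMonic_lt q hmonic fun h => by
      have := congrArg natDegree h
      rw [natDegree_X_pow_sub_C, natDegree_one] at this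
      exact two_ne_zero this
    rwa [natDegree_X_pow_sub_C] at h
  obtain ⟨a, b, hab⟩ := exists_eq_X_add_C_of_natDegree_le_one (Nat.lt_succ_iff.1 hlt)
  refine ⟨b, b.2, a, a.2, ?_⟩
  change aeval α q = _
  rw [← aeval_modByMonic_eq_self_of_root hroot, hab]
  simp [IntermediateField.algebraMap_apply, add_comm]

theorem eq_of_add_mul_eq (hα : α ∉ k) {a b c d : E} (ha : a ∈ k) (hb : b ∈ k) (hc : c ∈ k)
    (hd : d ∈ k) (h : a + b * α = c + d * α) : a = c ∧ b = d := by
  have hbd : b = d := by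
    by_contra hne
    have h0 : b - d ≠ 0 := sub_ne_zero.2 hne
    have : α = (c - a) / (b - d) := by
      rw [eq_div_iff h0]
      linear_combination h
    exact hα (this ▸ div_mem (sub_mem hc ha) (sub_mem hb hd))
  subst hbd
  exact ⟨add_right_cancel h, rfl⟩

/-- If `a + b * α` is a square in `k(α)`, then its norm `a ^ 2 - b ^ 2 * α ^ 2` is one in `k`. -/
theorem exists_sq_eq_norm (hα2 : α ^ 2 ∈ k) (hα : α ∉ k) {a b z : E} (ha : a ∈ k) (hb : b ∈ k)
    (hz : z ∈ adjoinOver k α) (h : z ^ 2 = a + b * α) :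
    ∃ w ∈ k, w ^ 2 = a ^ 2 - b ^ 2 * α ^ 2 := by
  obtain ⟨x, hx, y, hy, rfl⟩ := exists_eq_add_mul hα2 hz
  have h' : (x ^ 2 + y ^ 2 * α ^ 2) + 2 * x * y * α = a + b * α := by
    rw [← h]
    ring
  obtain ⟨h1, h2⟩ := eq_of_add_mul_eq hα (add_mem (pow_mem hx 2) (mul_mem (pow_mem hy 2) hα2))
    (mul_mem (mul_mem (ofNat_mem k 2) hx) hy) ha hb h'
  refine ⟨x ^ 2 - y ^ 2 * α ^ 2, sub_mem (pow_mem hx 2) (mul_mem (pow_mem hy 2) hα2), ?_⟩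
  rw [← h1, ← h2]
  ring

/-- If `c` is a square in `k(α)`, then `c` or `c / α ^ 2` is a square in `k`. -/
theorem exists_sq_eq_or (h2 : (2 : E) ≠ 0) (hα2 : α ^ 2 ∈ k) (hα : α ∉ k) {c z : E} (hc : c ∈ k)
    (hz : z ∈ adjoinOver k α) (h : z ^ 2 = c) : ∃ w ∈ k, w ^ 2 = c ∨ w ^ 2 * α ^ 2 = c := by
  obtain ⟨x, hx, y, hy, rfl⟩ := exists_eq_add_mul hα2 hz
  have h' : (x ^ 2 + y ^ 2 * α ^ 2) + 2 * x * y * α = c + 0 * α := by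
    rw [← h]
    ring
  obtain ⟨h3, h4⟩ := eq_of_add_mul_eq hα (add_mem (pow_mem hx 2) (mul_mem (pow_mem hy 2) hα2))
    (mul_mem (mul_mem (ofNat_mem k 2) hx) hy) hc (zero_mem k) h'
  rcases mul_eq_zero.1 h4 with h5 | h5
  · have hx0 : x = 0 := by simpa [h2] using h5
    exact ⟨y, hy, Or.inr (by rw [← h3, hx0]; ring)⟩
  · exact ⟨x, hx, Or.inl (by rw [← h3, h5]; ring)⟩

/-- A cubic polynomial `x ^ 3 + p * x + q` without a root in `k` has no root in `k(α)`. -/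
theorem cubic_ne_zero_of_adjoinOver (hα2 : α ^ 2 ∈ k) (hα : α ∉ k) {p q : E} (hp : p ∈ k)
    (hq : q ∈ k) (h : ∀ x ∈ k, x ^ 3 + p * x + q ≠ 0) :
    ∀ x ∈ adjoinOver k α, x ^ 3 + p * x + q ≠ 0 := by
  intro z hz h0
  obtain ⟨x, hx, y, hy, rfl⟩ := exists_eq_add_mul hα2 hz
  have h' : (x ^ 3 + 3 * x * y ^ 2 * α ^ 2 + p * x + q) +
      (3 * x ^ 2 * y + y ^ 3 * α ^ 2 + p * y) * α = 0 + 0 * α := by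
    rw [zero_mul, add_zero, ← h0]
    ring
  have h3 : (3 : E) ∈ k := ofNat_mem k 3
  obtain ⟨h1, h2⟩ := eq_of_add_mul_eq hα
    (add_mem (add_mem (add_mem (pow_mem hx 3)
      (mul_mem (mul_mem (mul_mem h3 hx) (pow_mem hy 2)) hα2)) (mul_mem hp hx)) hq)
    (add_mem (add_mem (mul_mem (mul_mem h3 (pow_mem hx 2)) hy) (mul_mem (pow_mem hy 3) hα2))
      (mul_mem hp hy)) (zero_mem k) (zero_mem k) h'
  by_cases hy0 : y = 0
  · refine h x hx ?_
    rw [← h1, hy0]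
    ring
  · have h5 : 3 * x ^ 2 + y ^ 2 * α ^ 2 + p = 0 := by
      refine (mul_eq_zero.1 ?_).resolve_right hy0
      linear_combination h2
    -- The conjugate x - yα is also a root, and the three roots sum to 0, so the third is -2x, which
    -- lies in k.
    refine h (-2 * x) (mul_mem (neg_mem (ofNat_mem k 2)) hx) ?_
    linear_combination h1 - 3 * x * h5

theorem finrank_adjoinOver_cubic {p q : E} (hp : p ∈ k) (hq : q ∈ k)
    (h : ∀ x ∈ k, x ^ 3 + p * x + q ≠ 0) (hα : α ^ 3 + p * α + q = 0) :
    Module.finrank F (adjoinOver k α) = Module.finrank F k * 3 := by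
  have hlt : (C (⟨p, hp⟩ : k) * X + C (⟨q, hq⟩ : k)).degree < 3 :=
    lt_of_le_of_lt degree_linear_le (by norm_num)
  have hmonic : (X ^ 3 + (C (⟨p, hp⟩ : k) * X + C (⟨q, hq⟩ : k))).Monic :=
    monic_X_pow_add hlt
  have hdeg : (X ^ 3 + (C (⟨p, hp⟩ : k) * X + C (⟨q, hq⟩ : k))).natDegree = 3 := by
    compute_degree!
  rw [finrank_adjoinOver hmonic (by rw [hdeg]; decide), hdeg]
  · intro x hx
    refine h x x.2 ?_
    have h' := congrArg (algebraMap k E) hx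
    simpa [IntermediateField.algebraMap_apply, add_assoc] using h'
  · simpa [IntermediateField.algebraMap_apply, add_assoc] using hα

end Tower

end SIC6
namespace SIC6

/-! ### A descent modulo 5 for the cubic over ℚ(√21). -/

section CubicRoots

/-- Since 21 ≡ 1 modulo 5, the combinations `h1` ± `h2` are the homogenized cubics x³ + 3x + 3 and
x³ + 2x + 1 at (a ± b, c). Neither has a root in 𝔽₅. -/
theorem five_dvd_of_cubic (a b c : ZMod 5)
    (h1 : a ^ 3 + 63 * a * b ^ 2 - 15 * a * c ^ 2 + 63 * b * c ^ 2 - 28 * c ^ 3 = 0)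
    (h2 : 3 * a ^ 2 * b + 21 * b ^ 3 - 15 * b * c ^ 2 + 3 * a * c ^ 2 + 6 * c ^ 3 = 0) :
    a = 0 ∧ b = 0 ∧ c = 0 := by
  revert a b c
  decide +kernel

/-- Infinite descent on |c|: all three integers are divisible by 5, and homogeneity lets the factor
be removed. -/
theorem eq_zero_of_cubic (n : ℕ) : ∀ a b c : ℤ, c.natAbs ≤ n →
    a ^ 3 + 63 * a * b ^ 2 - 15 * a * c ^ 2 + 63 * b * c ^ 2 - 28 * c ^ 3 = 0 →
    3 * a ^ 2 * b + 21 * b ^ 3 - 15 * b * c ^ 2 + 3 * a * c ^ 2 + 6 * c ^ 3 = 0 → c = 0 := by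
  induction n with
  | zero =>
    intro a b c hc _ _
    omega
  | succ n ih =>
    intro a b c hc h1 h2
    have h1' := congrArg (Int.cast : ℤ → ZMod 5) h1
    have h2' := congrArg (Int.cast : ℤ → ZMod 5) h2
    push_cast at h1' h2'
    obtain ⟨ha, hb, hc'⟩ := five_dvd_of_cubic _ _ _ h1' h2'
    obtain ⟨a, rfl⟩ := (ZMod.intCast_zmod_eq_zero_iff_dvd a 5).1 ha
    obtain ⟨b, rfl⟩ := (ZMod.intCast_zmod_eq_zero_iff_dvd b 5).1 hb
    obtain ⟨c, rfl⟩ := (ZMod.intCast_zmod_eq_zero_iff_dvd c 5).1 hc'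
    push_cast at *
    have h0 : c = 0 := by
      by_cases hc0 : c = 0
      · exact hc0
      · refine ih a b c (by omega) ?_ ?_
        · linarith
        · linarith
    rw [h0, mul_zero]

/-- The cubic `x ^ 3 - 3 (5 - √21) x + 6 √21 - 28` has no root `a + b √21` with rational `a, b`. -/
theorem not_rational_cubic (a b : ℚ) (h1 : a ^ 3 + 63 * a * b ^ 2 - 15 * a + 63 * b - 28 = 0)
    (h2 : 3 * a ^ 2 * b + 21 * b ^ 3 - 15 * b + 3 * a + 6 = 0) : False := by
  have hc : (a.den * b.den : ℤ) ≠ 0 := by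
    exact_mod_cast mul_ne_zero a.den_ne_zero b.den_ne_zero
  refine hc (eq_zero_of_cubic _ (a.num * b.den) (b.num * a.den) (a.den * b.den) le_rfl ?_ ?_)
  · have ha : (a.num : ℚ) = a * a.den := (Rat.mul_den_eq_num a).symm
    have hb : (b.num : ℚ) = b * b.den := (Rat.mul_den_eq_num b).symm
    rw [← Int.cast_inj (α := ℚ)]
    push_cast
    rw [ha, hb]
    linear_combination ((a.den : ℚ) * b.den) ^ 3 * h1
  · have ha : (a.num : ℚ) = a * a.den := (Rat.mul_den_eq_num a).symm
    have hb : (b.num : ℚ) = b * b.den := (Rat.mul_den_eq_num b).symm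
    rw [← Int.cast_inj (α := ℚ)]
    push_cast
    rw [ha, hb]
    linear_combination ((a.den : ℚ) * b.den) ^ 3 * h2

end CubicRoots

noncomputable section

/-! ### The degree of the field and membership of the entries. -/

section Degree

open IntermediateField

theorem ofReal_sqrt_sq (n : ℕ) : ((√(n : ℝ) : ℝ) : ℂ) ^ 2 = n := by
  rw [← Complex.ofReal_pow, Real.sq_sqrt n.cast_nonneg, Complex.ofReal_natCast]

/-- A rational number with a square root in `ℚ ⊆ ℂ` is a rational square. -/
theorem isSquare_of_mem_bot {q : ℚ} {w : ℂ} (hw : w ∈ (⊥ : IntermediateField ℚ ℂ))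
    (h : w ^ 2 = q) : IsSquare q := by
  obtain ⟨r, rfl⟩ := IntermediateField.mem_bot.1 hw
  refine ⟨r, ?_⟩
  have h' : ((r ^ 2 : ℚ) : ℂ) = q := by
    rw [← h]
    simp
  rw [← Rat.cast_injective h', sq]

theorem ratCast_mem (k : IntermediateField ℚ ℂ) (q : ℚ) : (q : ℂ) ∈ k := by
  simp

/-- The field `ℚ(√21)`. -/
def K₁ : IntermediateField ℚ ℂ := adjoinOver ⊥ ((√21 : ℝ) : ℂ)

/-- The field `ℚ(√21, √3)`. -/
def K₂ : IntermediateField ℚ ℂ := adjoinOver K₁ ((√3 : ℝ) : ℂ)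

/-- The field `ℚ(√21, √3, θ₁)`. -/
def K₃ : IntermediateField ℚ ℂ := adjoinOver K₂ (θ₁ : ℂ)

/-- The field `ℚ(√21, √3, θ₁, θ₃)`. -/
def K₄ : IntermediateField ℚ ℂ := adjoinOver K₃ (θ₃ : ℂ)

/-- The field `ℚ(√21, √3, θ₁, θ₃, i)`. -/
def K₅ : IntermediateField ℚ ℂ := adjoinOver K₄ Complex.I

theorem twentyOne_sq : ((√21 : ℝ) : ℂ) ^ 2 = 21 := by
  simpa using ofReal_sqrt_sq 21

theorem three_sq : ((√3 : ℝ) : ℂ) ^ 2 = 3 := by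
  simpa using ofReal_sqrt_sq 3

theorem twentyOne_sq_mem : ((√21 : ℝ) : ℂ) ^ 2 ∈ (⊥ : IntermediateField ℚ ℂ) := by
  rw [twentyOne_sq]
  exact ofNat_mem _ 21

theorem three_sq_mem : ((√3 : ℝ) : ℂ) ^ 2 ∈ K₁ := by
  rw [three_sq]
  exact ofNat_mem _ 3

theorem twentyOne_notMem : ((√21 : ℝ) : ℂ) ∉ (⊥ : IntermediateField ℚ ℂ) := fun h => by
  have h' : IsSquare (21 : ℚ) := isSquare_of_mem_bot h (by rw [twentyOne_sq]; norm_num)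
  norm_num at h'

/-- If a rational number is a square in `ℚ(√21)`, then it is a rational square, possibly up to
the factor `21`. -/
theorem isSquare_or_of_mem {q : ℚ} {z : ℂ} (hz : z ∈ K₁) (h : z ^ 2 = q) :
    IsSquare q ∨ IsSquare (q / 21) := by
  obtain ⟨w, hw, h1 | h1⟩ := exists_sq_eq_or two_ne_zero twentyOne_sq_mem twentyOne_notMem
    (ratCast_mem _ q) hz h
  · exact Or.inl (isSquare_of_mem_bot hw h1)
  · refine Or.inr (isSquare_of_mem_bot hw ?_)
    rw [twentyOne_sq] at h1
    push_cast
    linear_combination h1 / 21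

theorem three_notMem : ((√3 : ℝ) : ℂ) ∉ K₁ := fun h => by
  rcases isSquare_or_of_mem (q := 3) h (by rw [three_sq]; norm_num) with h' | h' <;> norm_num at h'

theorem sq_ne_six {z : ℂ} (hz : z ∈ K₁) : z ^ 2 ≠ 6 := fun h => by
  rcases isSquare_or_of_mem (q := 6) hz (by rw [h]; norm_num) with h' | h' <;> norm_num at h'

theorem sqrt_twentyOne_mem : ((√21 : ℝ) : ℂ) ∈ K₁ := mem_adjoinOver

theorem K₁_le_K₂ : K₁ ≤ K₂ := le_adjoinOver

theorem K₂_le_K₃ : K₂ ≤ K₃ := le_adjoinOver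

theorem K₃_le_K₄ : K₃ ≤ K₄ := le_adjoinOver

theorem K₄_le_K₅ : K₄ ≤ K₅ := le_adjoinOver

theorem θ₁_sq_complex : (θ₁ : ℂ) ^ 2 = (3 * ((√21 : ℝ) : ℂ) + 9) / 224 := by
  exact_mod_cast congrArg Complex.ofReal θ₁_sq

theorem θ₃_sq_complex : (θ₃ : ℂ) ^ 2 =
    (7 + ((√21 : ℝ) : ℂ)) / 48384 * (3 + ((√3 : ℝ) : ℂ)) := by
  have h : θ₃ ^ 2 = (7 + √21) / 48384 * (3 + √3) := by
    rw [θ₃_sq, sqrt_twentyOne]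
    linear_combination -(√7 / 48384) * sqrt_three_sq
  exact_mod_cast congrArg Complex.ofReal h

theorem θ₁_sq_mem : (θ₁ : ℂ) ^ 2 ∈ K₁ := by
  rw [θ₁_sq_complex]
  exact div_mem (add_mem (mul_mem (ofNat_mem _ 3) sqrt_twentyOne_mem) (ofNat_mem _ 9))
    (ofNat_mem _ 224)

/-- Elements of `ℚ(√21)` of negative norm are not squares. -/
theorem norm_nonneg_of_sq {a b : ℚ} {z : ℂ} (hz : z ∈ K₁)
    (h : z ^ 2 = a + b * ((√21 : ℝ) : ℂ)) : 0 ≤ a ^ 2 - b ^ 2 * 21 := by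
  obtain ⟨w, hw, h1⟩ := exists_sq_eq_norm twentyOne_sq_mem twentyOne_notMem (ratCast_mem _ a)
    (ratCast_mem _ b) hz h
  refine (isSquare_of_mem_bot hw ?_).nonneg
  rw [h1, twentyOne_sq]
  push_cast
  ring

/-- Otherwise θ₁² or θ₁² / 3 would be a square in ℚ(√21), but both have negative norm. -/
theorem θ₁_notMem : (θ₁ : ℂ) ∉ K₂ := fun h => by
  obtain ⟨w, hw, h1 | h1⟩ := exists_sq_eq_or two_ne_zero three_sq_mem three_notMem θ₁_sq_mem h rfl
  · have h2 := norm_nonneg_of_sq (a := 9 / 224) (b := 3 / 224) hw (by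
      rw [h1, θ₁_sq_complex]
      push_cast
      ring)
    norm_num at h2
  · have h2 := norm_nonneg_of_sq (a := 3 / 224) (b := 1 / 224) hw (by
      rw [three_sq, θ₁_sq_complex] at h1
      push_cast
      linear_combination h1 / 3)
    norm_num at h2

/-- The norm of e (3 + √3) down to ℚ(√21) is 6 e², so a square root would make 6 a square there. -/
theorem sq_ne_mul {e z : ℂ} (he : e ∈ K₁) (he0 : e ≠ 0) (hz : z ∈ K₂) :
    z ^ 2 ≠ e * (3 + ((√3 : ℝ) : ℂ)) := fun h => by
  obtain ⟨w, hw, h1⟩ := exists_sq_eq_norm three_sq_mem three_notMem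
    (mul_mem he (ofNat_mem _ 3)) he hz (by rw [h]; ring)
  refine sq_ne_six (div_mem hw he) ?_
  rw [div_pow, h1, three_sq]
  field_simp
  ring

theorem θ₃_coeff_mem : (7 + ((√21 : ℝ) : ℂ)) / 48384 ∈ K₁ :=
  div_mem (add_mem (ofNat_mem _ 7) sqrt_twentyOne_mem) (ofNat_mem _ 48384)

theorem θ₃_coeff_ne_zero : (7 + ((√21 : ℝ) : ℂ)) / 48384 ≠ 0 := by
  have h : (0 : ℝ) < (7 + √21) / 48384 := by positivity
  exact_mod_cast h.ne'

theorem θ₁_pos : 0 < θ₁ := Real.sqrt_pos.2 (by positivity)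

theorem θ₁_ne_zero : (θ₁ : ℂ) ≠ 0 := Complex.ofReal_ne_zero.2 θ₁_pos.ne'

theorem θ₃_sq_mem : (θ₃ : ℂ) ^ 2 ∈ K₂ := by
  rw [θ₃_sq_complex]
  exact mul_mem (K₁_le_K₂ θ₃_coeff_mem) (add_mem (ofNat_mem _ 3) mem_adjoinOver)

/-- Both θ₃² and θ₃² / θ₁² have the form e (3 + √3) with nonzero e in ℚ(√21), hence neither is a
square in `K₂`. -/
theorem θ₃_notMem : (θ₃ : ℂ) ∉ K₃ := fun h => by
  obtain ⟨w, hw, h1 | h1⟩ :=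
    exists_sq_eq_or two_ne_zero (K₁_le_K₂ θ₁_sq_mem) θ₁_notMem θ₃_sq_mem h rfl
  · exact sq_ne_mul θ₃_coeff_mem θ₃_coeff_ne_zero hw (h1.trans θ₃_sq_complex)
  · refine sq_ne_mul (div_mem θ₃_coeff_mem θ₁_sq_mem)
      (div_ne_zero θ₃_coeff_ne_zero (pow_ne_zero 2 θ₁_ne_zero)) hw ?_
    rw [div_mul_eq_mul_div, eq_div_iff (pow_ne_zero 2 θ₁_ne_zero), h1, θ₃_sq_complex]

/-- The real numbers, as a subfield of `ℂ`. -/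
def realSubfield : IntermediateField ℚ ℂ := (Complex.ofRealAm.restrictScalars ℚ).fieldRange

theorem ofReal_mem_realSubfield (x : ℝ) : (x : ℂ) ∈ realSubfield := ⟨x, rfl⟩

theorem I_notMem : Complex.I ∉ K₄ := fun h => by
  have hle : K₄ ≤ realSubfield :=
    adjoinOver_le (adjoinOver_le (adjoinOver_le (adjoinOver_le bot_le
      (ofReal_mem_realSubfield _)) (ofReal_mem_realSubfield _)) (ofReal_mem_realSubfield _))
      (ofReal_mem_realSubfield _)
  obtain ⟨x, hx⟩ := hle h
  have h' := congrArg Complex.im hx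
  exact zero_ne_one ((Complex.ofReal_im x).symm.trans h')

theorem I_sq_mem : Complex.I ^ 2 ∈ K₄ := by
  rw [Complex.I_sq]
  exact neg_mem (one_mem _)

theorem finrank_K₅ : Module.finrank ℚ K₅ = 32 := by
  rw [K₅, finrank_adjoinOver_sqrt I_sq_mem I_notMem,
    K₄, finrank_adjoinOver_sqrt (K₂_le_K₃ θ₃_sq_mem) θ₃_notMem,
    K₃, finrank_adjoinOver_sqrt (K₁_le_K₂ θ₁_sq_mem) θ₁_notMem,
    K₂, finrank_adjoinOver_sqrt three_sq_mem three_notMem,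
    K₁, finrank_adjoinOver_sqrt twentyOne_sq_mem twentyOne_notMem, IntermediateField.finrank_bot]

theorem cubic_coeff_mem : -3 * (5 - ((√21 : ℝ) : ℂ)) ∈ K₁ :=
  mul_mem (neg_mem (ofNat_mem _ 3)) (sub_mem (ofNat_mem _ 5) sqrt_twentyOne_mem)

theorem cubic_const_mem : 6 * ((√21 : ℝ) : ℂ) - 28 ∈ K₁ :=
  sub_mem (mul_mem (ofNat_mem _ 6) sqrt_twentyOne_mem) (ofNat_mem _ 28)

theorem cubic_ne_zero_of_mem_K₁ : ∀ x ∈ K₁,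
    x ^ 3 + -3 * (5 - ((√21 : ℝ) : ℂ)) * x + (6 * ((√21 : ℝ) : ℂ) - 28) ≠ 0 := by
  intro x hx h0
  obtain ⟨a, ha, b, hb, rfl⟩ := exists_eq_add_mul twentyOne_sq_mem hx
  obtain ⟨a, rfl⟩ := IntermediateField.mem_bot.1 ha
  obtain ⟨b, rfl⟩ := IntermediateField.mem_bot.1 hb
  simp only [eq_ratCast] at h0
  have h : ((a ^ 3 + 63 * a * b ^ 2 - 15 * a + 63 * b - 28 : ℚ) : ℂ) +
      ((3 * a ^ 2 * b + 21 * b ^ 3 - 15 * b + 3 * a + 6 : ℚ) : ℂ) * ((√21 : ℝ) : ℂ) =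
      ((0 : ℚ) : ℂ) + ((0 : ℚ) : ℂ) * ((√21 : ℝ) : ℂ) := by
    push_cast
    linear_combination h0 - (3 * (a : ℂ) * b ^ 2 + b ^ 3 * ((√21 : ℝ) : ℂ) + 3 * b) * twentyOne_sq
  obtain ⟨h1, h2⟩ := eq_of_add_mul_eq twentyOne_notMem (ratCast_mem _ _) (ratCast_mem _ _)
    (ratCast_mem _ _) (ratCast_mem _ _) h
  exact not_rational_cubic a b (Rat.cast_injective h1) (Rat.cast_injective h2)

theorem cubic_ne_zero_of_mem_K₅ : ∀ x ∈ K₅,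
    x ^ 3 + -3 * (5 - ((√21 : ℝ) : ℂ)) * x + (6 * ((√21 : ℝ) : ℂ) - 28) ≠ 0 := by
  have hp := cubic_coeff_mem
  have hq := cubic_const_mem
  have h2 := cubic_ne_zero_of_adjoinOver three_sq_mem three_notMem hp hq cubic_ne_zero_of_mem_K₁
  replace hp := K₁_le_K₂ hp
  replace hq := K₁_le_K₂ hq
  have h3 := cubic_ne_zero_of_adjoinOver (K₁_le_K₂ θ₁_sq_mem) θ₁_notMem hp hq h2
  replace hp := K₂_le_K₃ hp
  replace hq := K₂_le_K₃ hq
  have h4 := cubic_ne_zero_of_adjoinOver (K₂_le_K₃ θ₃_sq_mem) θ₃_notMem hp hq h3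
  exact cubic_ne_zero_of_adjoinOver I_sq_mem I_notMem (K₃_le_K₄ hp) (K₃_le_K₄ hq) h4

variable {θ₂ : ℝ}

/-- Rescaling by θ₁ removes it from the constant term of `f`, leaving coefficients in ℚ(√21), where
the descent applies. -/
theorem cubic_eq_zero (hθ₂ : f θ₂ = 0) :
    (3 * (θ₂ : ℂ) / (2 * θ₁)) ^ 3 + -3 * (5 - ((√21 : ℝ) : ℂ)) * (3 * (θ₂ : ℂ) / (2 * θ₁)) +
      (6 * ((√21 : ℝ) : ℂ) - 28) = 0 := by
  have h : (3 * θ₂ / (2 * θ₁)) ^ 3 + -3 * (5 - √21) * (3 * θ₂ / (2 * θ₁)) + (6 * √21 - 28) = 0 := by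
    have h0 := θ₁_pos.ne'
    have h21 : √21 ^ 2 = (21 : ℝ) := Real.sq_sqrt (by norm_num)
    have h1 := θ₁_sq
    rw [f] at hθ₂
    -- This is `f` made homogeneous in θ₁ and θ₂: (√21 - 3)/28 = (4/3)(5 - √21) θ₁² and (21 -
    -- 5√21)/126 = (8/27)(6√21 - 28) θ₁².
    have h2 : θ₂ ^ 3 - 4 / 3 * (5 - √21) * θ₁ ^ 2 * θ₂ + 8 / 27 * (6 * √21 - 28) * θ₁ ^ 3 = 0 := by
      linear_combination hθ₂ + (-4 / 3 * (5 - √21) * θ₂ + 8 / 27 * (6 * √21 - 28) * θ₁) * h1 +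
        (θ₂ / 56 + θ₁ / 42) * h21
    field_simp
    linear_combination 27 * h2
  exact_mod_cast congrArg Complex.ofReal h

theorem K_eq : K θ₂ = adjoinOver K₅ (3 * (θ₂ : ℂ) / (2 * θ₁)) := by
  have h3 : ((√3 : ℝ) : ℂ) ∈ K θ₂ := subset_adjoin ℚ _ (by simp)
  have h7 : ((√7 : ℝ) : ℂ) ∈ K θ₂ := subset_adjoin ℚ _ (by simp)
  have ht1 : (θ₁ : ℂ) ∈ K θ₂ := subset_adjoin ℚ _ (by simp)
  have ht2 : (θ₂ : ℂ) ∈ K θ₂ := subset_adjoin ℚ _ (by simp)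
  have ht3 : (θ₃ : ℂ) ∈ K θ₂ := subset_adjoin ℚ _ (by simp)
  have hI : Complex.I ∈ K θ₂ := subset_adjoin ℚ _ (by simp)
  have h21 : ((√21 : ℝ) : ℂ) = ((√3 : ℝ) : ℂ) * ((√7 : ℝ) : ℂ) := by
    rw [sqrt_twentyOne, Complex.ofReal_mul]
  apply le_antisymm
  · have h : K₅ ≤ adjoinOver K₅ (3 * (θ₂ : ℂ) / (2 * θ₁)) := le_adjoinOver
    have m1 : (θ₁ : ℂ) ∈ K₅ := K₄_le_K₅ (K₃_le_K₄ mem_adjoinOver)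
    have m3 : ((√3 : ℝ) : ℂ) ∈ K₅ := K₄_le_K₅ (K₃_le_K₄ (K₂_le_K₃ mem_adjoinOver))
    have m21 : ((√21 : ℝ) : ℂ) ∈ K₅ :=
      K₄_le_K₅ (K₃_le_K₄ (K₂_le_K₃ (K₁_le_K₂ sqrt_twentyOne_mem)))
    refine adjoin_le_iff.2 ?_
    rintro x (rfl | rfl | rfl | rfl | rfl | rfl)
    · exact h m3
    · have h0 : ((√3 : ℝ) : ℂ) ≠ 0 := by
        exact_mod_cast (Real.sqrt_pos.2 (by norm_num : (0 : ℝ) < 3)).ne'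
      have h7' : ((√7 : ℝ) : ℂ) = ((√21 : ℝ) : ℂ) / ((√3 : ℝ) : ℂ) := by
        rw [h21, mul_div_cancel_left₀ _ h0]
      exact h (h7' ▸ div_mem m21 m3)
    · exact h m1
    · have h2 : (θ₂ : ℂ) = 3 * (θ₂ : ℂ) / (2 * θ₁) * (2 * θ₁ / 3) := by
        have := θ₁_ne_zero
        field_simp
      have hm : 3 * (θ₂ : ℂ) / (2 * θ₁) * (2 * θ₁ / 3) ∈
          adjoinOver K₅ (3 * (θ₂ : ℂ) / (2 * θ₁)) :=
        mul_mem mem_adjoinOver (h (div_mem (mul_mem (ofNat_mem _ 2) m1) (ofNat_mem _ 3)))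
      rwa [← h2] at hm
    · exact h (K₄_le_K₅ mem_adjoinOver)
    · exact h mem_adjoinOver
  · refine adjoinOver_le (adjoinOver_le (adjoinOver_le (adjoinOver_le (adjoinOver_le
      (adjoinOver_le bot_le ?_) h3) ht1) ht3) hI) ?_
    · exact h21 ▸ mul_mem h3 h7
    · exact div_mem (mul_mem (ofNat_mem _ 3) ht2) (mul_mem (ofNat_mem _ 2) ht1)

theorem finrank_K (hθ₂ : f θ₂ = 0) : Module.finrank ℚ (K θ₂) = 96 := by
  have hle : K₁ ≤ K₅ := K₁_le_K₂.trans (K₂_le_K₃.trans (K₃_le_K₄.trans K₄_le_K₅))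
  rw [K_eq, finrank_adjoinOver_cubic (hle cubic_coeff_mem) (hle cubic_const_mem)
    cubic_ne_zero_of_mem_K₅ (cubic_eq_zero hθ₂), finrank_K₅]

theorem φ₀_mem_K (j : Fin 6) : φ₀ θ₂ j ∈ K θ₂ := by
  have h3 : ((√3 : ℝ) : ℂ) ∈ K θ₂ := subset_adjoin ℚ _ (by simp)
  have h7 : ((√7 : ℝ) : ℂ) ∈ K θ₂ := subset_adjoin ℚ _ (by simp)
  have ht1 : (θ₁ : ℂ) ∈ K θ₂ := subset_adjoin ℚ _ (by simp)
  have ht2 : (θ₂ : ℂ) ∈ K θ₂ := subset_adjoin ℚ _ (by simp)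
  have ht3 : (θ₃ : ℂ) ∈ K θ₂ := subset_adjoin ℚ _ (by simp)
  have hI : Complex.I ∈ K θ₂ := subset_adjoin ℚ _ (by simp)
  have hQ : ∀ y, (evalThree y : ℂ) ∈ K θ₂ := fun y => by
    simp only [evalThree, QuadExt.eval, Complex.ofReal_add, Complex.ofReal_mul,
      Complex.ofReal_intCast]
    exact add_mem (intCast_mem _ _) (mul_mem (intCast_mem _ _) h3)
  have hQ7 : ∀ y, (QuadInt.eval y : ℂ) ∈ K θ₂ := fun y => by
    simp only [QuadInt.eval, QuadExt.eval, Complex.ofReal_add, Complex.ofReal_mul]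
    exact add_mem (hQ _) (mul_mem (hQ _) h7)
  have hQt : ∀ y, (ThetaInt.eval y : ℂ) ∈ K θ₂ := fun y => by
    simp only [ThetaInt.eval, QuadExt.eval, Complex.ofReal_add, Complex.ofReal_mul,
      Complex.ofReal_ofNat]
    exact add_mem (hQ7 _) (mul_mem (hQ7 _) (mul_mem (ofNat_mem _ 56) ht1))
  have hR : ∀ y, (RealInt.eval θ₂ y : ℂ) ∈ K θ₂ := fun y => by
    have hx : 84 * (θ₂ : ℂ) ∈ K θ₂ := mul_mem (ofNat_mem _ 84) ht2
    simp only [RealInt.eval, CubicExt.eval, Complex.ofReal_add, Complex.ofReal_mul,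
      Complex.ofReal_pow, Complex.ofReal_ofNat]
    exact add_mem (add_mem (hQt _) (mul_mem (hQt _) hx)) (mul_mem (hQt _) (pow_mem hx 2))
  have hv : vec θ₂ j = toComplex θ₂ (scaledVec j) / 1176 := by
    rw [toComplex_scaledVec]
    ring
  change (θ₃ : ℂ) * vec θ₂ j ∈ K θ₂
  rw [hv]
  exact mul_mem ht3 (div_mem (add_mem (hR _) (mul_mem (hR _) hI)) (ofNat_mem _ 1176))

end Degree

end

end SIC6

theorem mainTheorem2 (θ₂ : ℝ) (hθ₂ : SIC6.f θ₂ = 0) :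
    Module.finrank ℚ (SIC6.K θ₂) = 96 ∧
    (∀ j : Fin 6, SIC6.φ₀ θ₂ j ∈ SIC6.K θ₂) ∧
    SIC6.IsHeisenbergFiducial 6 (SIC6.φ₀ θ₂) ∧
    ∀ a b : Fin 6, (a, b) ≠ (0, 0) →
      ‖star (SIC6.φ₀ θ₂) ⬝ᵥ
        ((SIC6.shiftX 6 ^ (a : ℕ) * SIC6.phaseZ 6 ^ (b : ℕ)).mulVec (SIC6.φ₀ θ₂))‖ ^ 2 = 1 / 7 := by
  refine ⟨SIC6.finrank_K hθ₂, SIC6.φ₀_mem_K, ?_, SIC6.norm_φ₀_overlap_sq hθ₂⟩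
  refine SIC6.isHeisenbergFiducial_of_overlaps (SIC6.φ₀_dotProduct_self hθ₂) fun a b hab => ?_
  refine (SIC6.norm_φ₀_overlap_sq hθ₂ a b hab).trans ?_
  norm_num
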